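/- **Proposition 6.2.** Let $E$ be an elliptic curve over a finite field $\mathbb{F}_q$ with $|E(\mathbb{F}_q)|=n+1$, let $O$ be the zero element of the group $E(\mathbb{F}_q)$, let $E(\mathbb{F}_q)^*=E(\mathbb{F}_q)\setminus\{O\}=\{P_1,\dots,P_n\}$, $D=P_1+\cdots+P_n$ and $G=kO$ with $1\le k\le n-1$. Let $$C=C_{\mathscr L}(D,G)=\{(f(P_1),\dots,f(P_n)) : f\in\mathscr L(G)\}\subseteq\mathbb{F}_q^n,\qquad \mathscr L(G)=\{f\in\mathbb{F}_q(E)^\times:\operatorname{div}(f)\ge -G\}\cup\{0\},$$ and let $d$ be the minimum distance of $C$. Let $\mathcal B_k$ (resp. $\mathcal B_k^*$) be the set of all $k$-element subsets of $E(\mathbb{F}_q)$ (resp. $E(\mathbb{F}_q)^*$) whose elements sum to $O$. A linear code of length $n$, dimension $m$ and minimum distance $d'$ is MDS if $d'=n-m+1$, almost MDS if $d'=n-m$, and NMDS (near MDS) if it and its dual code are both almost MDS. A finite set $V$ with a family of subsets of $V$ (blocks) is a $t$-design ($t\ge 0$) if there are integers $l\ge 1$ and $s$ with $t\le s\le |V|$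 such that every block has exactly $s$ elements and every $t$-element subset of $V$ is contained in exactly $l$ blocks. Then $\dim C=k$, and: (i) $C$ is MDS if and only if $d=n-k+1$, if and only if $\mathcal B_k^*=\emptyset$; and $C$ is NMDS if and only if $d=n-k$, if and only if $\mathcal B_k^*\neq\emptyset$. (ii) If $C$ is NMDS, then for every $t$ the set $\{1,\dots,n\}$ with the supports of the minimum-weight codewords of $C$ as blocks is a $t$-design if and only if $(E(\mathbb{F}_q)^*,\mathcal B_k^*)$ is a $t$-design. (iii) If $(E(\mathbb{F}_q),\mathcal B_k)$ is a $1$-design, then $C$ is NMDS. -/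

import Mathlib

open WeierstrassCurve.Affine Polynomial
open scoped WithZero

namespace EllipticCode

/-! ## Places, divisors and Riemann-Roch spaces of a function field -/

/-- A place of the function field `K` over the constant field `F`, i.e. a closed point of the
corresponding smooth projective curve, given by its local ring: a discrete valuation ring with
fraction field `K` that contains `F`. -/
structure Place (F K : Type*) [Field F] [Field K] [Algebra F K] where
  ring : ValuationSubring K
  algebraMap_mem : ∀ c : F, algebraMap F K c ∈ ring
  isDVR : IsDiscreteValuationRing ring

attribute [instance] Place.isDVR

/-- A divisor: a finite formal integer combination of places. -/
abbrev Divisor (F K : Type*) [Field F] [Field K] [Algebra F K] := Place F K →₀ ℤ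

section FunctionField

variable {F K : Type*} [Field F] [Field K] [Algebra F K]

/-- The normalised valuation of `K` at a place, in multiplicative notation. -/
noncomputable def Place.val (P : Place F K) : Valuation K ℤᵐ⁰ :=
  (IsDiscreteValuationRing.maximalIdeal P.ring).valuation K

/-- The order `v_P(f)` of vanishing of `f` at the place `P` (only meaningful for `f ≠ 0`). -/
noncomputable def Place.ord (P : Place F K) (f : K) : ℤ := -WithZero.log (P.val f)

/-- The rational function `f` is regular at `P` and takes there the value `c` of the constant
field: `f - c` lies in the maximal ideal of the local ring. -/
def Place.HasValue (P : Place F K) (f : K) (c : F) : Prop :=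
  f - algebraMap F K c ∈ P.ring.nonunits

theorem Place.val_le_one (P : Place F K) {f : K} (h : f ∈ P.ring) : P.val f ≤ 1 :=
  (IsDiscreteValuationRing.maximalIdeal P.ring).valuation_le_one (⟨f, h⟩ : P.ring)

theorem Place.le_ord_iff (P : Place F K) {f : K} (hf : f ≠ 0) (m : ℤ) :
    m ≤ P.ord f ↔ P.val f ≤ WithZero.exp (-m) := by
  have h0 : P.val f ≠ 0 := (Valuation.ne_zero_iff _).mpr hf
  rw [← WithZero.log_le_iff_le_exp h0, Place.ord]
  omega

theorem Place.smul_mem_nonunits (P : Place F K) {a f : K} (ha : a ∈ P.ring)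
    (hf : f ∈ P.ring.nonunits) : a * f ∈ P.ring.nonunits := by
  rw [ValuationSubring.mem_nonunits_iff] at *
  rw [map_mul]
  exact (mul_le_of_le_one_left' ((P.ring.valuation_le_one_iff _).mpr ha)).trans_lt hf

/-- The Riemann-Roch space `L(G) = {f ∈ Kˣ | div(f) ≥ -G} ∪ {0}`. -/
noncomputable def riemannRochSpace (G : Divisor F K) : Submodule F K where
  carrier := {f | f ≠ 0 → ∀ P : Place F K, -(G P) ≤ P.ord f}
  zero_mem' := fun h => absurd rfl h
  add_mem' := by
    intro f g hf hg hfg P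
    by_cases hf0 : f = 0
    · subst hf0
      rw [zero_add] at hfg ⊢
      exact hg hfg P
    by_cases hg0 : g = 0
    · subst hg0
      rw [add_zero] at hfg ⊢
      exact hf hf0 P
    have h1 := (P.le_ord_iff hf0 _).mp (hf hf0 P)
    have h2 := (P.le_ord_iff hg0 _).mp (hg hg0 P)
    exact (P.le_ord_iff hfg _).mpr ((Valuation.map_add _ _ _).trans (max_le h1 h2))
  smul_mem' := by
    intro c f hf hcf P
    have hf0 : f ≠ 0 := by
      rintro rfl
      exact hcf (smul_zero c)
    rw [P.le_ord_iff hcf, Algebra.smul_def, map_mul]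
    exact (mul_le_of_le_one_left' (P.val_le_one (P.algebraMap_mem c))).trans
      ((P.le_ord_iff hf0 _).mp (hf hf0 P))

/-- The algebraic geometry code `C_L(D, G)` for `D = P₁ + ⋯ + Pₙ`: all words
`(f(P₁), …, f(Pₙ))` with `f ∈ L(G)`. -/
noncomputable def agCode {n : ℕ} (P : Fin n → Place F K) (G : Divisor F K) :
    Submodule F (Fin n → F) where
  carrier := {c | ∃ f ∈ riemannRochSpace G, ∀ i, (P i).HasValue f (c i)}
  zero_mem' := ⟨0, Submodule.zero_mem _, fun i => by simp [Place.HasValue, zero_mem]⟩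
  add_mem' := by
    rintro c d ⟨f, hf, hfc⟩ ⟨g, hg, hgd⟩
    refine ⟨f + g, Submodule.add_mem _ hf hg, fun i => ?_⟩
    have h := add_mem (hfc i) (hgd i)
    rw [Place.HasValue, Pi.add_apply, map_add]
    convert h using 1
    ring
  smul_mem' := by
    rintro a c ⟨f, hf, hfc⟩
    refine ⟨a • f, Submodule.smul_mem _ a hf, fun i => ?_⟩
    have h := (P i).smul_mem_nonunits ((P i).algebraMap_mem a) (hfc i)
    rw [Place.HasValue, Pi.smul_apply, smul_eq_mul, map_mul, Algebra.smul_def, ← mul_sub]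
    exact h

end FunctionField

/-! ## The places at the rational points of a Weierstrass curve -/

section Points

variable {F : Type*} [Field F] {W : WeierstrassCurve.Affine F}

/-- The coordinate function `x` in the function field. -/
noncomputable def xFun (W : WeierstrassCurve.Affine F) : W.FunctionField :=
  algebraMap W.CoordinateRing W.FunctionField (CoordinateRing.mk W (C X))

/-- The coordinate function `y` in the function field. -/
noncomputable def yFun (W : WeierstrassCurve.Affine F) : W.FunctionField :=
  algebraMap W.CoordinateRing W.FunctionField (CoordinateRing.mk W X)

/-- The place `P` is the one at the given rational point: at `O` the function `x` has a pole, and at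
an affine point `(a, b)` the functions `x - a` and `y - b` vanish. -/
def Place.IsCenteredAt (P : Place F W.FunctionField) : W.Point → Prop
  | .zero => xFun W ∉ P.ring
  | .some a b _ => P.HasValue (xFun W) a ∧ P.HasValue (yFun W) b

theorem Place.ext' {K : Type*} [Field K] [Algebra F K] {P Q : Place F K} (h : P.ring = Q.ring) : P = Q := by
  cases P; cases Q; cases h; rfl

theorem Place.ring_ne_top {K : Type*} [Field K] [Algebra F K] (P : Place F K) : P.ring ≠ ⊤ := by
  intro h
  obtain ⟨π, hπ⟩ := IsDiscreteValuationRing.exists_irreducible P.ring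
  apply hπ.not_isUnit
  have h1 : ∀ z : K, z ∈ P.ring := by intro z; rw [h]; trivial
  have h0 : (π : K) ≠ 0 := fun h0 => hπ.ne_zero (Subtype.ext h0)
  exact IsUnit.of_mul_eq_one ⟨_, h1 (π : K)⁻¹⟩ (Subtype.ext (mul_inv_cancel₀ h0))

theorem Place.eq_of_le {K : Type*} [Field K] [Algebra F K] {P Q : Place F K} (h : P.ring ≤ Q.ring) : P = Q :=
  Place.ext' (ValuationSubring.eq_of_le_of_ne_top P.ring h Q.ring_ne_top)

theorem Place.coord_mem (P : Place F W.FunctionField) (hx : xFun W ∈ P.ring) (hy : yFun W ∈ P.ring)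
    (r : W.CoordinateRing) : algebraMap _ W.FunctionField r ∈ P.ring := by
  have key : ∀ p : F[X], algebraMap W.CoordinateRing W.FunctionField (CoordinateRing.mk W (C p)) ∈ P.ring := by
    intro p
    induction p using Polynomial.induction_on' with
    | add p q hp hq => simpa using add_mem hp hq
    | monomial n a =>
      rw [← C_mul_X_pow_eq_monomial]
      simp only [map_mul, map_pow]
      exact mul_mem (P.algebraMap_mem a) (pow_mem hx n)
  obtain ⟨p, q, rfl⟩ := CoordinateRing.exists_smul_basis_eq r
  rw [CoordinateRing.smul, CoordinateRing.smul, map_add, map_mul, map_mul, map_one, mul_one]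
  exact add_mem (key p) (mul_mem (key q) hy)


theorem norm_ne {r : W.CoordinateRing} (h : r ≠ 0) : Algebra.norm F[X] r ≠ 0 :=
  (Algebra.norm_ne_zero_iff_of_basis (CoordinateRing.basis W)).mpr h

theorem norm_degree_add_le (r s : W.CoordinateRing) : (Algebra.norm F[X] (r + s)).degree ≤
    max (Algebra.norm F[X] r).degree (Algebra.norm F[X] s).degree := by
  obtain ⟨p, q, rfl⟩ := CoordinateRing.exists_smul_basis_eq r
  obtain ⟨p', q', rfl⟩ := CoordinateRing.exists_smul_basis_eq s
  have h : p • (1 : W.CoordinateRing) + q • CoordinateRing.mk W X +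
      (p' • (1 : W.CoordinateRing) + q' • CoordinateRing.mk W X) =
      (p + p') • (1 : W.CoordinateRing) + (q + q') • CoordinateRing.mk W X := by
    rw [add_smul, add_smul]; abel
  rw [h]
  simp only [CoordinateRing.degree_norm_smul_basis]
  refine max_le ?_ ?_
  · rcases le_max_iff.mp (degree_add_le p p') with h | h
    · exact le_max_of_le_left (le_max_of_le_left (nsmul_le_nsmul_right h 2))
    · exact le_max_of_le_right (le_max_of_le_left (nsmul_le_nsmul_right h 2))
  · rcases le_max_iff.mp (degree_add_le q q') with h | h
    · exact le_max_of_le_left (le_max_of_le_right (by gcongr))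
    · exact le_max_of_le_right (le_max_of_le_right (by gcongr))

/-- The valuation on the affine coordinate ring sending `r ≠ 0` to `exp (deg N(r))`, where `N` is
the norm to `F[X]`; only used to prove that the place at infinity exists. -/
noncomputable def degVal (W : WeierstrassCurve.Affine F) : Valuation W.CoordinateRing ℤᵐ⁰ where
  toFun r := if r = 0 then 0 else WithZero.exp ((Algebra.norm F[X] r).natDegree : ℤ)
  map_zero' := by simp
  map_one' := by simp
  map_mul' r s := by
    by_cases hr : r = 0
    · simp [hr]
    by_cases hs : s = 0
    · simp [hs]
    simp only [hr, hs, mul_eq_zero, or_self, if_false, map_mul]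
    rw [natDegree_mul (norm_ne hr) (norm_ne hs)]
    push_cast
    rw [WithZero.exp_add]
  map_add_le_max' r s := by
    by_cases hr : r = 0
    · simp [hr]
    by_cases hs : s = 0
    · simp [hs]
    by_cases hrs : r + s = 0
    · simp [hrs]
    simp only [hr, hs, hrs, if_false]
    rcases le_max_iff.mp (norm_degree_add_le r s) with h | h
    · refine le_max_of_le_left ?_
      simpa using natDegree_le_natDegree h
    · refine le_max_of_le_right ?_
      simpa using natDegree_le_natDegree h

theorem degVal_apply {r : W.CoordinateRing} (h : r ≠ 0) :
    degVal W r = WithZero.exp ((Algebra.norm F[X] r).natDegree : ℤ) := if_neg h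

theorem degVal_smul_one {p : F[X]} (hp : p ≠ 0) :
    degVal W (CoordinateRing.mk W (C p)) = WithZero.exp (2 * p.natDegree : ℤ) := by
  have h : CoordinateRing.mk W (C p) = p • 1 + (0 : F[X]) • CoordinateRing.mk W X := by
    rw [CoordinateRing.smul]; simp
  have hd := CoordinateRing.degree_norm_smul_basis (W' := W) p 0
  rw [← h, degree_zero] at hd
  have hd' : (Algebra.norm F[X] (CoordinateRing.mk W (C p))).degree = ((2 * p.natDegree : ℕ) : WithBot ℕ) := by
    rw [hd, degree_eq_natDegree hp]
    simp
  have h0 : CoordinateRing.mk W (C p) ≠ 0 := by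
    intro h0
    have := Module.Finite.of_basis (CoordinateRing.basis W)
    rw [h0, Algebra.norm_zero, degree_zero] at hd'
    exact WithBot.bot_ne_coe hd'
  rw [degVal_apply h0, natDegree_eq_of_degree_eq_some hd']
  simp

theorem exists_place_zero : ∃! P : Place F W.FunctionField, P.IsCenteredAt (.zero) := by
  have hsupp : nonZeroDivisors W.CoordinateRing ≤ (degVal W).supp.primeCompl := by
    intro r hr h
    have hr0 := nonZeroDivisors.ne_zero hr
    have h' : degVal W r = 0 := h
    rw [degVal_apply hr0] at h'
    exact WithZero.exp_ne_zero h'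
  let v : Valuation W.FunctionField ℤᵐ⁰ := (degVal W).extendToLocalization hsupp W.FunctionField
  have hv : ∀ r, v (algebraMap _ _ r) = degVal W r := fun r =>
    Valuation.extendToLocalization_apply_map_apply _ _ _ _
  have hvx : v (xFun W) = WithZero.exp 2 := by
    rw [xFun, hv, degVal_smul_one X_ne_zero]; simp
  have hnt : Nontrivial (MonoidWithZeroHom.valueGroup (.ofClass v)) := by
    rw [Subgroup.nontrivial_iff_exists_ne_one]
    refine ⟨Units.mk0 (v (xFun W)) (by rw [hvx]; exact WithZero.exp_ne_zero), ?_, ?_⟩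
    · apply MonoidWithZeroHom.mem_valueGroup
      exact ⟨xFun W, rfl⟩
    · intro h
      have := congr_arg Units.val h
      rw [Units.val_mk0, hvx] at this
      exact absurd this (by decide)
  let P0 : Place F W.FunctionField :=
    { ring := v.valuationSubring
      algebraMap_mem := fun c => by
        rw [Valuation.mem_valuationSubring_iff]
        by_cases hc : c = 0
        · simp [hc]
        have : algebraMap F W.FunctionField c = algebraMap _ _ (CoordinateRing.mk W (C (C c))) := rfl
        rw [this, hv, degVal_smul_one (C_ne_zero.mpr hc)]
        simp
      isDVR := inferInstance }
  refine ⟨P0, ?_, ?_⟩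
  · change ¬ v (xFun W) ≤ 1
    rw [hvx]; decide
  · intro Q (hQ : xFun W ∉ Q.ring)
    symm
    apply Place.eq_of_le
    let w := Q.ring.valuation
    set A := w (xFun W) with hA
    have hA1 : 1 < A := by
      rw [← ValuationSubring.valuation_le_one_iff] at hQ
      exact not_le.mp hQ
    have : Valuation.IsTrivialOn F w := ⟨fun c hc => by
      have h1 := (Q.ring.valuation_le_one_iff _).mpr (Q.algebraMap_mem c)
      have h2 := (Q.ring.valuation_le_one_iff _).mpr (Q.algebraMap_mem c⁻¹)
      refine le_antisymm h1 ?_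
      rw [map_inv₀, map_inv₀] at h2
      have h3 : Q.ring.valuation (algebraMap F W.FunctionField c) ≠ 0 := by
        simpa using hc
      exact (inv_le_one₀ (zero_lt_iff.mpr h3)).mp h2⟩
    have hpoly : ∀ p : F[X], p ≠ 0 →
        w (algebraMap _ _ (CoordinateRing.mk W (C p))) = A ^ p.natDegree := by
      intro p hp
      rw [hA, ← Polynomial.valuation_aeval_eq_valuation_X_pow_natDegree_of_one_lt_valuation_X
        (v := w) (xFun W) hA1 hp]
      congr 1
      clear hp
      induction p using Polynomial.induction_on' with
      | add p q hp hq => rw [C_add, map_add, map_add, map_add, hp, hq]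
      | monomial n a =>
        rw [← C_mul_X_pow_eq_monomial]
        simp only [map_mul, map_pow, aeval_C, aeval_X]
        rfl
    have hA0 : 0 < A := zero_lt_one.trans hA1
    have hlin : w (algebraMap _ _ (CoordinateRing.mk W (C (C W.a₁ * X + C W.a₃)))) ≤ A := by
      by_cases h0 : C W.a₁ * X + C W.a₃ = 0
      · rw [h0]; simp [hA0.le]
      · rw [hpoly _ h0]
        calc A ^ _ ≤ A ^ 1 := pow_le_pow_right₀ hA1.le natDegree_linear_le
          _ = A := pow_one _
    have hcub : w (algebraMap _ _ (CoordinateRing.mk W (C (X ^ 3 + C W.a₂ * X ^ 2 + C W.a₄ * X + C W.a₆)))) =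
        A ^ 3 := by
      have hd : (X ^ 3 + C W.a₂ * X ^ 2 + C W.a₄ * X + C W.a₆).natDegree = 3 := by
        have := natDegree_cubic (a := (1 : F)) (b := W.a₂) (c := W.a₄) (d := W.a₆) one_ne_zero
        simpa using this
      rw [hpoly _ (by intro h; rw [h] at hd; simp at hd), hd]
    have heq : yFun W * (yFun W + algebraMap _ _ (CoordinateRing.mk W (C (C W.a₁ * X + C W.a₃)))) =
        algebraMap _ _ (CoordinateRing.mk W (C (X ^ 3 + C W.a₂ * X ^ 2 + C W.a₄ * X + C W.a₆))) := by
      rw [yFun, ← map_add, ← map_mul, ← map_add, ← map_mul]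
      congr 1
      have h0 : CoordinateRing.mk W W.polynomial = 0 := AdjoinRoot.mk_self
      apply sub_eq_zero.mp
      rw [← map_sub]
      convert h0 using 2
      simp only [WeierstrassCurve.Affine.polynomial]
      ring
    set B := w (yFun W) with hB
    have hB2 : B ^ 2 = A ^ 3 := by
      have h := congr_arg w heq
      rw [map_mul, hcub] at h
      by_cases hBA : B ≤ A
      · exfalso
        have h1 : w (yFun W + algebraMap _ _ (CoordinateRing.mk W (C (C W.a₁ * X + C W.a₃)))) ≤ A :=
          (Valuation.map_add _ _ _).trans (max_le hBA hlin)
        have h2 : A ^ 3 ≤ A ^ 2 := by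
          rw [← h, pow_two]; exact mul_le_mul' hBA h1
        exact absurd h2 (not_le.mpr (pow_lt_pow_right₀ hA1 (by norm_num)))
      · rw [Valuation.map_add_eq_of_lt_left _ (hlin.trans_lt (not_le.mp hBA))] at h
        rw [pow_two]; exact h
    have hval : ∀ r : W.CoordinateRing, r ≠ 0 →
        w (algebraMap _ _ r) ^ 2 = A ^ (Algebra.norm F[X] r).natDegree := by
      intro r hr
      obtain ⟨p, q, rfl⟩ := CoordinateRing.exists_smul_basis_eq r
      have hd := CoordinateRing.degree_norm_smul_basis (W' := W) p q
      have hpv : p ≠ 0 → w (algebraMap _ _ (p • (1 : W.CoordinateRing))) ^ 2 = A ^ (2 * p.natDegree) := by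
        intro hp
        rw [CoordinateRing.smul, mul_one, hpoly _ hp, ← pow_mul, mul_comm]
      have hqv : q ≠ 0 → w (algebraMap _ _ (q • CoordinateRing.mk W X)) ^ 2 = A ^ (2 * q.natDegree + 3) := by
        intro hq
        rw [CoordinateRing.smul, map_mul, map_mul, hpoly _ hq, mul_pow, pow_add, ← hB2, hB, yFun,
          ← pow_mul, mul_comm 2]
      by_cases hp : p = 0
      · by_cases hq : q = 0
        · simp [hp, hq] at hr
        · rw [hp, degree_zero, degree_eq_natDegree hq] at hd
          have hd' : _ = ((2 * q.natDegree + 3 : ℕ) : WithBot ℕ) := hd.trans (by simp)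
          rw [hp, natDegree_eq_of_degree_eq_some hd', zero_smul, zero_add, hqv hq]
      · by_cases hq : q = 0
        · rw [hq, degree_zero, degree_eq_natDegree hp] at hd
          have hd' : _ = ((2 * p.natDegree : ℕ) : WithBot ℕ) := hd.trans (by simp)
          rw [hq, natDegree_eq_of_degree_eq_some hd', zero_smul, add_zero, hpv hp]
        · rw [degree_eq_natDegree hp, degree_eq_natDegree hq] at hd
          have hd' : (Algebra.norm F[X] (p • (1 : W.CoordinateRing) + q • CoordinateRing.mk W X)).degree =
              ((max (2 * p.natDegree) (2 * q.natDegree + 3) : ℕ) : WithBot ℕ) := by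
            rw [hd, (Nat.mono_cast (α := WithBot ℕ)).map_max]; simp
          rw [natDegree_eq_of_degree_eq_some hd', map_add]
          rcases lt_or_gt_of_ne (show 2 * p.natDegree ≠ 2 * q.natDegree + 3 by omega) with hlt | hlt
          · rw [max_eq_right hlt.le, ← hqv hq, Valuation.map_add_eq_of_lt_right]
            refine lt_of_pow_lt_pow_left₀ 2 zero_le ?_
            rw [hpv hp, hqv hq]; exact pow_lt_pow_right₀ hA1 hlt
          · rw [max_eq_left hlt.le, ← hpv hp, Valuation.map_add_eq_of_lt_left]
            refine lt_of_pow_lt_pow_left₀ 2 zero_le ?_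
            rw [hpv hp, hqv hq]; exact pow_lt_pow_right₀ hA1 hlt
    intro f hf
    have hf' : v f ≤ 1 := hf
    obtain ⟨a, b, hb, rfl⟩ := IsFractionRing.div_surjective W.CoordinateRing f
    have hb0 := nonZeroDivisors.ne_zero hb
    rw [← ValuationSubring.valuation_le_one_iff]
    change w _ ≤ 1
    by_cases ha0 : a = 0
    · simp [ha0]
    rw [map_div₀, hv, hv, degVal_apply ha0, degVal_apply hb0, div_le_one₀ (by simp)] at hf'
    have hf'' : (Algebra.norm F[X] a).natDegree ≤ (Algebra.norm F[X] b).natDegree := by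
      simpa using hf'
    have hwb : 0 < w (algebraMap _ _ b) := by
      rw [zero_lt_iff]
      simpa using hb0
    rw [map_div₀, div_le_one₀ hwb]
    refine le_of_pow_le_pow_left₀ two_ne_zero zero_le ?_
    rw [hval a ha0, hval b hb0]
    exact pow_le_pow_right₀ hA1.le hf''

theorem exists_const {x y : F} (h : W.Nonsingular x y) (r : W.CoordinateRing) :
    ∃ c : F, r - algebraMap F _ c ∈ CoordinateRing.XYIdeal W x (C y) := by
  have hq : (W.polynomial.eval (C y)).eval x = 0 := h.1
  let e := CoordinateRing.quotientXYIdealEquiv hq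
  refine ⟨e (Ideal.Quotient.mk _ r), ?_⟩
  rw [← Ideal.Quotient.eq_zero_iff_mem]
  apply e.injective
  rw [map_sub, map_sub, map_zero]
  have : (Ideal.Quotient.mk (CoordinateRing.XYIdeal W x (C y))) (algebraMap F _ (e (Ideal.Quotient.mk _ r)))
     = algebraMap F _ (e (Ideal.Quotient.mk _ r)) := rfl
  rw [this, AlgEquiv.commutes]
  simp

theorem XYIdeal_isMaximal {x y : F} (h : W.Nonsingular x y) :
    (CoordinateRing.XYIdeal W x (C y)).IsMaximal := by
  have hq : (W.polynomial.eval (C y)).eval x = 0 := h.1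
  let e := CoordinateRing.quotientXYIdealEquiv hq
  apply Ideal.Quotient.maximal_of_isField
  exact MulEquiv.isField (Field.toIsField F) e.toMulEquiv

theorem exists_place_some {x y : F} (h : W.Nonsingular x y) :
    ∃! P : Place F W.FunctionField, P.IsCenteredAt (.some x y h) := by
  have hmax := XYIdeal_isMaximal h
  set I := CoordinateRing.XYIdeal W x (C y) with hI
  have hS : I.primeCompl ≤ nonZeroDivisors W.CoordinateRing := I.primeCompl_le_nonZeroDivisors
  let L := Localization.subalgebra.ofField W.FunctionField I.primeCompl hS
  have hmem : ∀ f, f ∈ L ↔ ∃ (a s : W.CoordinateRing) (_ : s ∈ I.primeCompl),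
    f = algebraMap _ W.FunctionField a * (algebraMap _ W.FunctionField s)⁻¹ := fun f => Iff.rfl
  have : IsLocalization.AtPrime L I := Localization.subalgebra.isLocalization_ofField _ _ hS
  have : IsLocalRing L := IsLocalization.AtPrime.isLocalRing L I
  have : IsNoetherianRing L := IsLocalization.isNoetherianRing I.primeCompl L inferInstance
  have hmaxL : IsLocalRing.maximalIdeal L = I.map (algebraMap _ L) :=
    (IsLocalization.AtPrime.map_eq_maximalIdeal I L).symm
  have hinj : Function.Injective (algebraMap W.CoordinateRing L) :=
    IsLocalization.injective L hS
  set t := CoordinateRing.XClass W x with ht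
  set s := CoordinateRing.YClass W (C y) with hs
  have htI : t ∈ I := Ideal.subset_span (by simp [t])
  have hsI : s ∈ I := Ideal.subset_span (by simp [s])
  let ι : F →+* W.CoordinateRing := algebraMap F _
  have hι : ∀ c : F, CoordinateRing.mk W (C (C c)) = ι c := fun c => rfl
  have hrel : s * (ι (2 * y + W.a₁ * x + W.a₃) + (s + ι W.a₁ * t)) =
      t * (ι (3 * x ^ 2 + 2 * W.a₂ * x + W.a₄ - W.a₁ * y) + t * (t + ι (3 * x + W.a₂))) := by
    have h0 : CoordinateRing.mk W W.polynomial = 0 := AdjoinRoot.mk_self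
    have h1 := congr_arg ι ((equation_iff ..).mp h.1)
    simp only [polynomial, map_add, map_sub, map_mul, map_pow, hι] at h0 h1
    simp only [t, s, CoordinateRing.XClass, CoordinateRing.YClass, map_add, map_sub, map_mul, map_pow, hι, map_ofNat]
    linear_combination h0 - h1
  have hunit : ∀ c : F, c ≠ 0 → ∀ m ∈ I, ι c + m ∈ I.primeCompl := by
    intro c hc m hm hcm
    have h2 : ι c ∈ I := by simpa using I.sub_mem hcm hm
    exact hmax.ne_top (Ideal.eq_top_of_isUnit_mem _ h2 ((isUnit_iff_ne_zero.mpr hc).map ι))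
  have hunitL : ∀ c : F, c ≠ 0 → ∀ m ∈ I, IsUnit (algebraMap _ L (ι c + m)) := fun c hc m hm =>
    IsLocalization.map_units L (⟨_, hunit c hc m hm⟩ : I.primeCompl)
  have hprinc : (IsLocalRing.maximalIdeal L).IsPrincipal := by
    have hspan : IsLocalRing.maximalIdeal L = Ideal.span {algebraMap _ L t, algebraMap _ L s} := by
      rw [hmaxL, hI, CoordinateRing.XYIdeal, Ideal.map_span, Set.image_pair]
    have hrelL := congr_arg (algebraMap _ L) hrel
    rw [map_mul, map_mul] at hrelL
    have hm1 : s + ι W.a₁ * t ∈ I := I.add_mem hsI (I.mul_mem_left _ htI)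
    have hm2 : t * (t + ι (3 * x + W.a₂)) ∈ I := I.mul_mem_right _ htI
    rcases ((nonsingular_iff' ..).mp h).2 with hb | ha
    · have hb' : 3 * x ^ 2 + 2 * W.a₂ * x + W.a₄ - W.a₁ * y ≠ 0 := by
        intro h0; apply hb; linear_combination -h0
      obtain ⟨u, hu⟩ := hunitL _ hb' _ hm2
      refine ⟨algebraMap _ L s, ?_⟩
      rw [hspan]
      apply le_antisymm
      · rw [Ideal.span_le]
        rintro z (rfl | rfl)
        · rw [← hu] at hrelL
          refine Ideal.mem_span_singleton'.mpr
            ⟨algebraMap _ L (ι (2 * y + W.a₁ * x + W.a₃) + (s + ι W.a₁ * t)) * ↑u⁻¹, ?_⟩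
          rw [mul_right_comm, mul_comm _ (algebraMap _ L s), hrelL, mul_assoc, Units.mul_inv,
            mul_one]
        · exact Ideal.mem_span_singleton_self _
      · exact Ideal.span_mono (by simp)
    · obtain ⟨u, hu⟩ := hunitL _ ha _ hm1
      refine ⟨algebraMap _ L t, ?_⟩
      rw [hspan]
      apply le_antisymm
      · rw [Ideal.span_le]
        rintro z (rfl | rfl)
        · exact Ideal.mem_span_singleton_self _
        · rw [← hu] at hrelL
          refine Ideal.mem_span_singleton'.mpr
            ⟨algebraMap _ L (ι (3 * x ^ 2 + 2 * W.a₂ * x + W.a₄ - W.a₁ * y) +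
              t * (t + ι (3 * x + W.a₂))) * ↑u⁻¹, ?_⟩
          rw [mul_right_comm, mul_comm _ (algebraMap _ L t), ← hrelL, mul_assoc, Units.mul_inv,
            mul_one]
      · exact Ideal.span_mono (by simp)
  have hnf : ¬ IsField L := by
    rw [IsLocalRing.isField_iff_maximalIdeal_eq, hmaxL, Ideal.map_eq_bot_iff_of_injective hinj]
    intro h0
    rw [h0] at htI
    exact CoordinateRing.XClass_ne_zero x htI
  have hdvr : IsDiscreteValuationRing L := ((IsDiscreteValuationRing.TFAE L hnf).out 4 0).mp hprinc
  let V : ValuationSubring W.FunctionField :=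
    { L.toSubring with
      mem_or_inv_mem' := by
        intro f
        rcases ValuationRing.isInteger_or_isInteger L f with ⟨a, ha⟩ | ⟨a, ha⟩
        · left; rw [← ha]; exact a.2
        · right; rw [← ha]; exact a.2 }
  have hVL : ∀ f, f ∈ V ↔ f ∈ L := fun f => Iff.rfl
  let e : V ≃+* L := RingEquiv.refl _
  let P0 : Place F W.FunctionField :=
    { ring := V
      algebraMap_mem := fun c => L.algebraMap_mem (ι c)
      isDVR := IsDiscreteValuationRing.RingEquivClass.isDiscreteValuationRing e.symm }
  have hnon : ∀ r ∈ I, algebraMap _ W.FunctionField r ∈ P0.ring.nonunits := by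
    intro r hr
    rw [ValuationSubring.mem_nonunits_iff_or]
    by_cases h0 : algebraMap _ W.FunctionField r = 0
    · exact .inl h0
    right
    intro hin
    obtain ⟨a, b, hb, hab⟩ := (hmem _).mp hin
    have hb0 : algebraMap _ W.FunctionField b ≠ 0 := by
      intro hb0
      have : b = 0 := (IsFractionRing.injective W.CoordinateRing W.FunctionField) (by rw [hb0, map_zero])
      exact hb (this ▸ I.zero_mem)
    apply hb
    have : b = r * a := by
      apply IsFractionRing.injective W.CoordinateRing W.FunctionField
      rw [map_mul]
      field_simp at hab
      exact hab
    rw [this]; exact I.mul_mem_right _ hr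
  refine ⟨P0, ⟨?_, ?_⟩, ?_⟩
  · convert hnon t htI using 1
    simp [xFun, t, CoordinateRing.XClass]; rfl
  · convert hnon s hsI using 1
    simp [yFun, s, CoordinateRing.YClass]; rfl
  · rintro Q ⟨hx, hy⟩
    have hxm : xFun W ∈ Q.ring := by
      simpa using add_mem (Q.ring.nonunits_subset hx) (Q.algebraMap_mem x)
    have hym : yFun W ∈ Q.ring := by
      simpa using add_mem (Q.ring.nonunits_subset hy) (Q.algebraMap_mem y)
    have hR := Q.coord_mem hxm hym
    have hIQ : ∀ r ∈ I, algebraMap _ W.FunctionField r ∈ Q.ring.nonunits := by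
      intro r hr
      obtain ⟨a, b, rfl⟩ := Ideal.mem_span_pair.mp hr
      rw [map_add, map_mul, map_mul]
      have h1 : algebraMap _ W.FunctionField (CoordinateRing.XClass W x) ∈ Q.ring.nonunits := by
        convert hx using 1
        simp [xFun, CoordinateRing.XClass]; rfl
      have h2 : algebraMap _ W.FunctionField (CoordinateRing.YClass W (C y)) ∈ Q.ring.nonunits := by
        convert hy using 1
        simp [yFun, CoordinateRing.YClass]; rfl
      rw [ValuationSubring.mem_nonunits_iff] at *
      have ha := (Q.ring.valuation_le_one_iff _).mpr (hR a)
      have hb := (Q.ring.valuation_le_one_iff _).mpr (hR b)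
      refine lt_of_le_of_lt (Valuation.map_add _ _ _) (max_lt ?_ ?_)
      · rw [map_mul]; exact (mul_le_of_le_one_left' ha).trans_lt h1
      · rw [map_mul]; exact (mul_le_of_le_one_left' hb).trans_lt h2
    symm
    apply Place.eq_of_le
    intro f hf
    obtain ⟨a, b, hb, rfl⟩ := (hmem f).mp hf
    refine mul_mem (hR a) ?_
    obtain ⟨c, hc⟩ := exists_const h b
    have hc0 : c ≠ 0 := by
      rintro rfl
      exact hb (by simpa using hc)
    have hv : Q.ring.valuation (algebraMap _ W.FunctionField b) = 1 := by
      have hcv : Q.ring.valuation (algebraMap F W.FunctionField c) = 1 := by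
        have h1 := (Q.ring.valuation_le_one_iff _).mpr (Q.algebraMap_mem c)
        have h2 := (Q.ring.valuation_le_one_iff _).mpr (Q.algebraMap_mem c⁻¹)
        refine le_antisymm h1 ?_
        rw [map_inv₀, map_inv₀] at h2
        have h3 : Q.ring.valuation (algebraMap F W.FunctionField c) ≠ 0 := by
          simpa using hc0
        exact (inv_le_one₀ (zero_lt_iff.mpr h3)).mp h2
      have h4 := (ValuationSubring.mem_nonunits_iff _).mp (hIQ _ hc)
      have h5 : algebraMap _ W.FunctionField b = algebraMap F W.FunctionField c +
        algebraMap _ W.FunctionField (b - algebraMap F _ c) := by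
        rw [map_sub, ← IsScalarTower.algebraMap_apply]; ring
      rw [h5, Valuation.map_add_eq_of_lt_left _ (by rw [hcv]; exact h4), hcv]
    rw [← ValuationSubring.valuation_le_one_iff, map_inv₀, hv, inv_one]

/-- Every rational point is the center of exactly one place of the function field. -/
theorem existsUnique_place (Q : W.Point) : ∃! P : Place F W.FunctionField, P.IsCenteredAt Q :=
  match Q with
  | .zero => exists_place_zero
  | .some _ _ h => exists_place_some h

/-- The place of the function field at a rational point of the curve. -/
noncomputable def placeAt (Q : W.Point) : Place F W.FunctionField :=
  (existsUnique_place Q).choose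

theorem placeAt_isCenteredAt (Q : W.Point) : (placeAt Q).IsCenteredAt Q :=
  (existsUnique_place Q).choose_spec.1

/-- The elliptic curve code `C_L(P₁ + ⋯ + Pₙ, k O)`. -/
noncomputable def ellipticCode (W : WeierstrassCurve.Affine F) {n : ℕ} (P : Fin n → W.Point)
    (k : ℕ) : Submodule F (Fin n → F) :=
  agCode (fun i => placeAt (P i)) (Finsupp.single (placeAt (.zero : W.Point)) (k : ℤ))

end Points

/-! ## Linear codes -/

section Codes

variable {F : Type*} [Field F] [DecidableEq F] {n : ℕ}

/-- The minimum distance of a (nonzero) linear code: the least weight of a nonzero codeword. -/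
noncomputable def minDist (C : Submodule F (Fin n → F)) : ℕ :=
  sInf {d | ∃ c ∈ C, c ≠ 0 ∧ hammingNorm c = d}

/-- The dual code for the standard bilinear form. -/
def dualCode (C : Submodule F (Fin n → F)) : Submodule F (Fin n → F) where
  carrier := {w | ∀ c ∈ C, ∑ i, c i * w i = 0}
  zero_mem' := by simp
  add_mem' := by
    intro v w hv hw c hc
    simp [mul_add, Finset.sum_add_distrib, hv c hc, hw c hc]
  smul_mem' := by
    intro a w hw c hc
    simp [mul_left_comm _ a, ← Finset.mul_sum, hw c hc]

/-- Maximum distance separable: `d = n - dim + 1`. -/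
def IsMDS (C : Submodule F (Fin n → F)) : Prop :=
  minDist C + Module.finrank F C = n + 1

/-- Almost MDS: `d = n - dim`. -/
def IsAMDS (C : Submodule F (Fin n → F)) : Prop :=
  minDist C + Module.finrank F C = n

/-- Near MDS: both the code and its dual are almost MDS. -/
def IsNMDS (C : Submodule F (Fin n → F)) : Prop :=
  IsAMDS C ∧ IsAMDS (dualCode C)

/-- The support of a word. -/
def wordSupport (c : Fin n → F) : Finset (Fin n) := Finset.univ.filter fun i => c i ≠ 0

/-- The set of supports of the codewords of minimum weight. -/
def minWeightSupports (C : Submodule F (Fin n → F)) : Set (Finset (Fin n)) :=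
  {B | ∃ c ∈ C, c ≠ 0 ∧ hammingNorm c = minDist C ∧ wordSupport c = B}

end Codes

/-! ## Designs and subset sums -/

/-- The incidence structure with point set `V` and blocks `𝓑` is a `t`-`(v, k, l)` design with
`v = |V|`: all blocks are `k`-subsets of `V`, where `t ≤ k ≤ v`, and every `t`-subset of `V` lies in
exactly `l ≥ 1` blocks. -/
structure IsDesign {α : Type*} (V : Set α) (𝓑 : Set (Finset α)) (t k l : ℕ) : Prop where
  t_le : t ≤ k
  le_card : k ≤ V.ncard
  pos : 1 ≤ l
  block_subset : ∀ B ∈ 𝓑, (B : Set α) ⊆ V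
  block_card : ∀ B ∈ 𝓑, B.card = k
  count : ∀ T : Finset α, (T : Set α) ⊆ V → T.card = t → {B ∈ 𝓑 | T ⊆ B}.ncard = l

/-- `(V, 𝓑)` is a `t`-design for some parameters `k` and `l`. -/
def IsTDesign {α : Type*} (V : Set α) (𝓑 : Set (Finset α)) (t : ℕ) : Prop :=
  ∃ k l, IsDesign V 𝓑 t k l

/-- The `k`-subsets of `V` whose elements sum to zero: `B_k` for `V = A`, and `B_k^*` for
`V = A \ {0}`. -/
def zeroSumSubsets {A : Type*} [AddCommGroup A] (V : Set A) (k : ℕ) : Set (Finset A) :=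
  {S | (S : Set A) ⊆ V ∧ S.card = k ∧ ∑ a ∈ S, a = 0}

end EllipticCode

open EllipticCode

/-! Let `R` be the affine coordinate ring. The Jacobian criterion makes `R` a Dedekind domain, so a
function with no pole outside `O` lies in `R`. The pole order at `O` of `r ∈ R` is the degree of its
norm to `F[X]`. Hence `L(kO)` is `poleSpace W k`, and writing `r = p + q y` shows that it has
dimension `k` for `k ≥ 1`.

Zeros are counted by linear algebra: `R/(f)` has dimension `deg N(f)`, and evaluation at a set `S`
of zeros of `f` maps it onto `F^S` by the Chinese remainder theorem. So `|S| ≤ deg N(f)`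
(`card_le_natDegree_norm`), and in case of equality `f` divides every function vanishing on `S`. A
nonzero codeword therefore has at most `k` zeros, while the dimension count gives one with at least
`k - 1` zeros; thus `d` is `n - k` or `n - k + 1`. The value `n - k` occurs exactly when some `f ∈
L(kO)` has a set `S` of `k` zeros. Then `f` generates the product of the maximal ideals of the
points of `S`, and since `E(F)` embeds in the class group of `R`, that product is principal iff the
points sum to `O` (`sum_eq_zero_iff_exists`).

For the dual code, functions in `L(kO)` separate a point from any `k - 2` others, so dual words have
weight at least `k`; a codeword with `k` zeros yields a dual word supported on them. Hence `d = n -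
k` already implies NMDS.

In that case the supports of minimum weight are the complements of the zero-sum index sets, and
complementation preserves `t`-designs unless every `k`-subset is a block. That exception is
excluded, since exchanging one point of a set changes its sum. Finally, in a `1`-design on `E(F)`
some block avoids `O`, and this block lies in `B_k^*`. -/

namespace EllipticCode

/-! ### Smoothness: the affine coordinate ring is a Dedekind domain. -/

section Smoothness

/-- Jacobian criterion: if `w` vanishes in the quotient `R` of `F[X][Y]` and `∂w/∂Y` does not lie in
the maximal ideal `M`, then `M` is locally generated by one element. -/
theorem exists_local_generator {F R : Type*} [Field F] [CommRing R] (φ : F[X][X] →+* R)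
    (hφ : Function.Surjective φ) (w : F[X][X]) (hw : φ w = 0) (M : Ideal R) [M.IsMaximal]
    (hd : φ (derivative w) ∉ M) :
    ∃ t ∈ M, ∀ z ∈ M, ∃ s ∉ M, t ∣ s * z := by
  have hM : (M.comap φ).IsMaximal := Ideal.comap_isMaximal_of_surjective φ hφ
  have hp := Polynomial.isMaximal_comap_C_of_isJacobsonRing (M.comap φ)
  obtain ⟨f, e, hfe⟩ : ∃ (f : F[X][X]) (e : F[X]), M.comap φ = Ideal.span {f} ⊔ Ideal.span {C e} := by
    obtain ⟨e, he⟩ := (IsPrincipalIdealRing.principal ((M.comap φ).comap C)).principal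
    have hmap : ((M.comap φ).comap C).map C = Ideal.span {C e} := by
      rw [he, Ideal.submodule_span_eq, Ideal.map_span, Set.image_singleton]
    -- A maximal ideal of `F[X][Y]` is generated by its contraction to `F[X]` and one further
    -- polynomial `f`; `f = 0` covers the case in which the contraction suffices.
    by_cases h : M.comap φ = ((M.comap φ).comap C).map C
    · exact ⟨0, e, by rw [← hmap, ← h]; simp⟩
    · obtain ⟨f, -, hf⟩ := exists_monic_span_sup_map_eq _ _ hp h
      exact ⟨f, e, by rw [← hmap, sup_comm]; exact hf⟩
  have hmem : ∀ g, φ g ∈ M ↔ ∃ a b, a * f + b * C e = g := by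
    intro g
    rw [← Ideal.mem_comap, hfe, ← Ideal.span_insert, Ideal.mem_span_pair]
  obtain ⟨h, b, hb⟩ := (hmem w).mp (by rw [hw]; exact M.zero_mem)
  have hf : φ f ∈ M := (hmem f).mpr ⟨1, 0, by ring⟩
  have he : φ (C e) ∈ M := (hmem _).mpr ⟨0, 1, by ring⟩
  -- Write `w = h f + b e`. If `h` were in the ideal, so would be `∂w/∂Y`; hence `h` is a local
  -- unit, and `h f = -b e` in `R` makes `f` a local multiple of `e`.
  refine ⟨φ (C e), he, fun z hz => ⟨φ h, fun hh => hd ?_, ?_⟩⟩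
  · rw [← hb]
    simp only [derivative_mul, derivative_C, mul_zero, add_zero, map_add, map_mul]
    exact M.add_mem (M.add_mem (M.mul_mem_left _ hf) (M.mul_mem_right _ hh)) (M.mul_mem_left _ he)
  · obtain ⟨g, rfl⟩ := hφ z
    obtain ⟨c, d, rfl⟩ := (hmem g).mp hz
    refine ⟨φ (h * d - c * b), ?_⟩
    have h1 : φ h * φ f = -(φ b * φ (C e)) := by
      rw [eq_neg_iff_add_eq_zero, ← map_mul, ← map_mul, ← map_add, hb, hw]
    simp only [map_add, map_sub, map_mul]
    linear_combination φ c * h1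

variable {F : Type*} [Field F] {W : WeierstrassCurve.Affine F}

theorem exists_local_generator_coordinateRing [W.IsElliptic] (M : Ideal W.CoordinateRing)
    [M.IsMaximal] : ∃ t ∈ M, ∀ z ∈ M, ∃ s ∉ M, t ∣ s * z := by
  let φ := CoordinateRing.mk W
  have hφ : Function.Surjective φ := AdjoinRoot.mk_surjective
  have h0 : φ W.polynomial = 0 := AdjoinRoot.mk_self
  let ι : F →+* W.CoordinateRing := φ.comp (C.comp C)
  have hι : ∀ c, φ (C (C c)) = ι c := fun c => rfl
  set x : W.CoordinateRing := φ (C X) with hx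
  set y : W.CoordinateRing := φ X with hy
  have heq : y ^ 2 + ι W.a₁ * x * y + ι W.a₃ * y - (x ^ 3 + ι W.a₂ * x ^ 2 + ι W.a₄ * x + ι W.a₆) = 0 := by
    simp only [polynomial, map_add, map_sub, map_mul, map_pow, hι] at h0
    linear_combination h0
  let : Field (W.CoordinateRing ⧸ M) := Ideal.Quotient.field M
  let q := Ideal.Quotient.mk M
  -- The residues of `x` and `y` form a point of the curve over the residue field of `M`. It is
  -- nonsingular, so one of the two partial derivatives is not in `M`. When it is the one in `X`,
  -- the criterion is applied to the presentation `ψ` with the roles of the variables exchanged.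
  by_cases hY : 2 * y + ι W.a₁ * x + ι W.a₃ ∈ M
  · have hX : ι W.a₁ * y - (3 * x ^ 2 + 2 * ι W.a₂ * x + ι W.a₄) ∉ M := by
      have hns : (W.map (q.comp ι)).Nonsingular (q x) (q y) := by
        have : (W.map (q.comp ι)).IsElliptic := inferInstance
        rw [← equation_iff_nonsingular, equation_iff']
        simpa [-map_eq_zero] using congr_arg q heq
      rw [nonsingular_iff'] at hns
      intro hX
      replace hX : q _ = 0 := Ideal.Quotient.eq_zero_iff_mem.mpr hX
      replace hY : q _ = 0 := Ideal.Quotient.eq_zero_iff_mem.mpr hY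
      simp only [map_add, map_sub, map_mul, map_pow, map_ofNat] at hX hY
      rcases hns.2 with h | h
      · exact h hX
      · exact h hY
    let ψ : F[X][X] →+* W.CoordinateRing := eval₂RingHom (eval₂RingHom ι y) x
    have hψC : ∀ c, ψ (C (C c)) = ι c := by simp [ψ]
    have hψX : ψ X = x := by simp [ψ]
    have hψY : ψ (C X) = y := by simp [ψ]
    let w : F[X][X] := C X ^ 2 + C (C W.a₁) * X * C X + C (C W.a₃) * C X -
      (X ^ 3 + C (C W.a₂) * X ^ 2 + C (C W.a₄) * X + C (C W.a₆))
    refine exists_local_generator ψ ?_ w ?_ M ?_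
    · intro r
      obtain ⟨p, q, rfl⟩ := CoordinateRing.exists_smul_basis_eq r
      have hC : ∀ p : F[X], ψ (p.map C) = φ (C p) := by
        intro p
        induction p using Polynomial.induction_on' with
        | add p q hp hq => simp only [Polynomial.map_add, map_add, hp, hq]
        | monomial n a =>
          rw [← C_mul_X_pow_eq_monomial, Polynomial.map_mul, Polynomial.map_pow, map_C, map_X]
          simp only [map_mul, map_pow, hψC, hψX, hι, ← hx]
      refine ⟨p.map C + q.map C * C X, ?_⟩
      rw [map_add, map_mul, hC, hC, hψY, CoordinateRing.smul, CoordinateRing.smul, mul_one]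
    · simp only [w, map_add, map_sub, map_mul, map_pow, hψC, hψX, hψY]
      exact heq
    · convert hX using 2
      simp only [w, derivative_mul, derivative_C, derivative_X, map_add, map_sub, map_mul, map_pow, hψC, hψX, hψY, map_zero, map_one,
        derivative_pow, map_natCast]
      push_cast
      ring
  · refine exists_local_generator φ hφ _ h0 M ?_
    convert hY using 2
    simp only [polynomial, derivative_mul, derivative_C, derivative_X, map_add,
      map_sub, map_mul, map_pow, hι, map_zero, map_one, map_natCast, derivative_pow, ← hx, ← hy]
    push_cast
    ring

instance : Module.Finite F[X] W.CoordinateRing := .of_basis (CoordinateRing.basis W)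

/-- The local generator makes the maximal ideal of each localization principal, so each localization
at a nonzero prime is a discrete valuation ring. -/
instance [W.IsElliptic] : IsDedekindDomain W.CoordinateRing := by
  have hdim : Ring.DimensionLEOne W.CoordinateRing := .of_isIntegral F[X] _
  have : IsDedekindDomainDvr W.CoordinateRing := by
    refine { is_dvr_at_nonzero_prime := fun M hM0 hM => ?_ }
    have : M.IsMaximal := hM.isMaximal hM0
    obtain ⟨t, ht, htM⟩ := exists_local_generator_coordinateRing M
    set L := Localization.AtPrime M
    have hinj : Function.Injective (algebraMap W.CoordinateRing L) :=
      IsLocalization.injective L M.primeCompl_le_nonZeroDivisors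
    have hmax : IsLocalRing.maximalIdeal L = M.map (algebraMap _ L) :=
      (IsLocalization.AtPrime.map_eq_maximalIdeal M L).symm
    have hnf : ¬ IsField L := by
      rw [IsLocalRing.isField_iff_maximalIdeal_eq, hmax, Ideal.map_eq_bot_iff_of_injective hinj]
      exact hM0
    have : IsNoetherianRing L := IsLocalization.isNoetherianRing M.primeCompl L inferInstance
    suffices hprinc : (IsLocalRing.maximalIdeal L).IsPrincipal from
      ((IsDiscreteValuationRing.TFAE L hnf).out 4 0).mp hprinc
    refine ⟨algebraMap _ L t, ?_⟩
    rw [hmax, Ideal.submodule_span_eq]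
    refine le_antisymm (Ideal.map_le_iff_le_comap.mpr fun z hz => ?_) ?_
    · obtain ⟨s, hs, c, hc⟩ := htM z hz
      obtain ⟨u, hu⟩ := IsLocalization.map_units L (⟨s, hs⟩ : M.primeCompl)
      refine Ideal.mem_span_singleton'.mpr ⟨↑u⁻¹ * algebraMap _ L c, ?_⟩
      rw [mul_assoc, Units.inv_mul_eq_iff_eq_mul, hu, ← map_mul, ← map_mul, hc, mul_comm]
    · exact (Ideal.span_singleton_le_iff_mem _).mpr (Ideal.mem_map_of_mem _ ht)
  infer_instance

end Smoothness

/-! ### Places of the function field, and `L(kO)` as a subspace of the coordinate ring. -/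

section Places

section FunctionField
variable {F K : Type*} [Field F] [Field K] [Algebra F K]

theorem Place.val_le_one_iff (P : Place F K) {f : K} : P.val f ≤ 1 ↔ f ∈ P.ring := by
  refine ⟨fun h => ?_, P.val_le_one⟩
  obtain ⟨a, rfl⟩ := IsDiscreteValuationRing.exists_lift_of_le_one h
  exact a.2

/-- A surjective valuation with value group `ℤ` whose valuation ring is the local ring of `P` is the
normalised valuation at `P`. -/
theorem Place.val_eq_of_valuationSubring_eq (P : Place F K) (v : Valuation K ℤᵐ⁰)
    (hv : v.valuationSubring = P.ring) {t : K} (ht : v t = WithZero.exp (-1 : ℤ)) (f : K) :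
    P.val f = v f := by
  have he : v.IsEquiv P.val := Valuation.isEquiv_iff_val_le_one.mpr fun {x} => by
    rw [P.val_le_one_iff, ← hv, Valuation.mem_valuationSubring_iff]
  obtain ⟨π, hπ⟩ := (IsDiscreteValuationRing.maximalIdeal P.ring).valuation_exists_uniformizer K
  change P.val π = _ at hπ
  have hle : ∀ a : ℤᵐ⁰, a < 1 → a ≤ WithZero.exp (-1 : ℤ) := by
    intro a ha
    by_cases h0 : a = 0
    · simp [h0]
    · rw [← WithZero.log_le_iff_le_exp h0]
      have := (WithZero.log_lt_iff_lt_exp h0).mpr (show a < WithZero.exp 0 by simpa using ha)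
      omega
  have h1 : WithZero.exp (-1 : ℤ) < 1 := by decide
  -- `exp (-1)` is the largest value below `1`, and equivalent valuations agree on order, so `t` and
  -- `π` are uniformizers for both valuations.
  have htv : P.val t = WithZero.exp (-1 : ℤ) := by
    refine le_antisymm (hle _ ((Valuation.isEquiv_iff_val_lt_one.mp he).mp (ht ▸ h1))) ?_
    rw [← hπ]
    refine (he _ _).mp ?_
    rw [ht]
    exact hle _ ((Valuation.isEquiv_iff_val_lt_one.mp he).mpr (hπ ▸ h1))
  by_cases hf : f = 0
  · simp [hf]
  have hvf : v f ≠ 0 := (Valuation.ne_zero_iff _).mpr hf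
  -- `f` has the same `v`-value as a power of `t`; equivalence transfers this equality to `P.val`.
  have h2 : v f = v (t ^ (-WithZero.log (v f))) := by
    rw [map_zpow₀, ht, ← WithZero.exp_zsmul]
    simp [WithZero.exp_log hvf]
  rw [he.eq_iff.mp h2, map_zpow₀, htv, ← ht, ← map_zpow₀, ← h2]

end FunctionField

variable {F : Type*} [Field F] {W : WeierstrassCurve.Affine F}

theorem eq_placeAt {P : Place F W.FunctionField} {Q : W.Point} (h : P.IsCenteredAt Q) :
    P = placeAt Q :=
  (existsUnique_place Q).unique h (placeAt_isCenteredAt Q)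

theorem degVal_Y : degVal W (CoordinateRing.mk W X) = WithZero.exp 3 := by
  have h : CoordinateRing.mk W X = (0 : F[X]) • 1 + (1 : F[X]) • CoordinateRing.mk W X := by
    simp
  have hd := CoordinateRing.degree_norm_smul_basis (W' := W) 0 1
  rw [← h, degree_zero, degree_one] at hd
  have hd' : (Algebra.norm F[X] (CoordinateRing.mk W X)).degree = ((3 : ℕ) : WithBot ℕ) := by
    rw [hd]; simp
  have h0 : CoordinateRing.mk W X ≠ 0 := by
    intro h0
    rw [h0, Algebra.norm_zero, degree_zero] at hd'
    exact WithBot.bot_ne_coe hd'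
  rw [degVal_apply h0, natDegree_eq_of_degree_eq_some hd']
  simp

/-- The norm degree extends to a valuation of the function field at which `x` has a pole, so its
ring is that of the place at `O`. It is normalised because `x` and `y` have pole orders `2` and `3`,
so that `x / y` is a uniformizer. -/
theorem placeAt_zero_val (r : W.CoordinateRing) :
    (placeAt (.zero : W.Point)).val (algebraMap _ _ r) = degVal W r := by
  have hsupp : nonZeroDivisors W.CoordinateRing ≤ (degVal W).supp.primeCompl := by
    intro r hr h
    have h' : degVal W r = 0 := h
    rw [degVal_apply (nonZeroDivisors.ne_zero hr)] at h'
    exact WithZero.exp_ne_zero h'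
  let v : Valuation W.FunctionField ℤᵐ⁰ := (degVal W).extendToLocalization hsupp W.FunctionField
  have hv : ∀ r, v (algebraMap _ _ r) = degVal W r := fun r =>
    Valuation.extendToLocalization_apply_map_apply _ _ _ _
  have hvx : v (xFun W) = WithZero.exp 2 := by
    rw [xFun, hv, degVal_smul_one X_ne_zero]; simp
  have hvy : v (yFun W) = WithZero.exp 3 := by rw [yFun, hv, degVal_Y]
  have hnt : Nontrivial (MonoidWithZeroHom.valueGroup (.ofClass v)) := by
    rw [Subgroup.nontrivial_iff_exists_ne_one]
    refine ⟨Units.mk0 (v (xFun W)) (by rw [hvx]; exact WithZero.exp_ne_zero),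
      MonoidWithZeroHom.mem_valueGroup _ ⟨xFun W, rfl⟩, fun h => ?_⟩
    have := congr_arg Units.val h
    rw [Units.val_mk0, hvx] at this
    exact absurd this (by decide)
  let P : Place F W.FunctionField :=
    { ring := v.valuationSubring
      algebraMap_mem := fun c => by
        rw [Valuation.mem_valuationSubring_iff]
        by_cases hc : c = 0
        · simp [hc]
        have : algebraMap F W.FunctionField c = algebraMap _ _ (CoordinateRing.mk W (C (C c))) := rfl
        rw [this, hv, degVal_smul_one (C_ne_zero.mpr hc)]
        simp
      isDVR := inferInstance }
  have hP : P.IsCenteredAt (.zero : W.Point) := by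
    change ¬ v (xFun W) ≤ 1
    rw [hvx]; decide
  rw [← eq_placeAt hP, P.val_eq_of_valuationSubring_eq v rfl (t := xFun W / yFun W), hv]
  rw [map_div₀, hvx, hvy]
  decide

/-- The place of the function field of an elliptic curve at a nonzero prime of the affine
coordinate ring. -/
noncomputable def placeOfPrime [W.IsElliptic]
    (v : IsDedekindDomain.HeightOneSpectrum W.CoordinateRing) : Place F W.FunctionField where
  ring := (v.valuation W.FunctionField).valuationSubring
  algebraMap_mem c := v.valuation_le_one (algebraMap F W.CoordinateRing c)
  isDVR := by
    obtain ⟨π, hπ⟩ := v.valuation_exists_uniformizer W.FunctionField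
    have hnt : Nontrivial (MonoidWithZeroHom.valueGroup (.ofClass (v.valuation W.FunctionField))) := by
      rw [Subgroup.nontrivial_iff_exists_ne_one]
      refine ⟨Units.mk0 (v.valuation W.FunctionField π) (by rw [hπ]; exact WithZero.exp_ne_zero),
        MonoidWithZeroHom.mem_valueGroup _ ⟨π, rfl⟩, fun h => ?_⟩
      have := congr_arg Units.val h
      rw [Units.val_mk0, hπ] at this
      exact absurd this (by decide)
    infer_instance

/-- Away from `O` the function `x` is regular, and `y` is integral over `F[x]` by the Weierstrass
equation. -/
theorem coord_mem_of_ne_placeAt_zero {P : Place F W.FunctionField}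
    (hP : P ≠ placeAt (.zero : W.Point)) (r : W.CoordinateRing) :
    algebraMap _ W.FunctionField r ∈ P.ring := by
  have hx : xFun W ∈ P.ring := by
    by_contra h
    exact hP (eq_placeAt h)
  refine P.coord_mem hx ?_ r
  have hF : ∀ c : F, algebraMap _ W.FunctionField (CoordinateRing.mk W (C (C c))) ∈ P.ring :=
    P.algebraMap_mem
  have heq : yFun W * (yFun W + (algebraMap _ _ (CoordinateRing.mk W (C (C W.a₁))) * xFun W +
      algebraMap _ _ (CoordinateRing.mk W (C (C W.a₃))))) =
      xFun W ^ 3 + algebraMap _ _ (CoordinateRing.mk W (C (C W.a₂))) * xFun W ^ 2 +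
        algebraMap _ _ (CoordinateRing.mk W (C (C W.a₄))) * xFun W +
        algebraMap _ _ (CoordinateRing.mk W (C (C W.a₆))) := by
    have h0 : algebraMap _ W.FunctionField (CoordinateRing.mk W W.polynomial) = 0 := by
      rw [show CoordinateRing.mk W W.polynomial = 0 from AdjoinRoot.mk_self, map_zero]
    simp only [polynomial, map_add, map_sub, map_mul, map_pow] at h0
    rw [xFun, yFun]
    linear_combination h0
  rcases P.ring.mem_or_inv_mem (yFun W) with h | h
  · exact h
  have hy0 : yFun W ≠ 0 := by
    rw [yFun, ne_eq, FaithfulSMul.algebraMap_eq_zero_iff]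
    have := CoordinateRing.YClass_ne_zero (W' := W) 0
    rwa [CoordinateRing.YClass, C_0, sub_zero] at this
  -- If `y⁻¹` is regular, dividing the Weierstrass equation by `y` expresses `y` through regular
  -- functions.
  rw [show yFun W = (yFun W)⁻¹ * (xFun W ^ 3 +
        algebraMap _ _ (CoordinateRing.mk W (C (C W.a₂))) * xFun W ^ 2 +
        algebraMap _ _ (CoordinateRing.mk W (C (C W.a₄))) * xFun W +
        algebraMap _ _ (CoordinateRing.mk W (C (C W.a₆)))) -
      (algebraMap _ _ (CoordinateRing.mk W (C (C W.a₁))) * xFun W +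
        algebraMap _ _ (CoordinateRing.mk W (C (C W.a₃)))) by
    rw [← heq, inv_mul_cancel_left₀ hy0, add_sub_cancel_right]]
  exact sub_mem (mul_mem h (add_mem (add_mem (add_mem (pow_mem hx 3)
    (mul_mem (hF _) (pow_mem hx 2))) (mul_mem (hF _) hx)) (hF _)))
    (add_mem (mul_mem (hF _) hx) (hF _))

variable (W) in
/-- The functions in the affine coordinate ring with a pole of order at most `k` at infinity. -/
noncomputable def poleSpace (k : ℕ) : Submodule F W.CoordinateRing where
  carrier := {r | (Algebra.norm F[X] r).natDegree ≤ k}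
  zero_mem' := by simp
  add_mem' {r s} hr hs := by
    rw [Set.mem_ofPred_eq, natDegree_le_iff_degree_le] at *
    exact (norm_degree_add_le r s).trans (max_le hr hs)
  smul_mem' c r hr := by
    have : c • r = algebraMap F[X] W.CoordinateRing (C c) * r := Algebra.smul_def c r
    rw [Set.mem_ofPred_eq, this, map_mul, Algebra.norm_algebraMap, ← C_pow]
    exact (natDegree_C_mul_le _ _).trans hr

theorem mem_poleSpace {k : ℕ} {r : W.CoordinateRing} :
    r ∈ poleSpace W k ↔ (Algebra.norm F[X] r).natDegree ≤ k := Iff.rfl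

/-- A function regular at every nonzero prime of a Dedekind domain belongs to it, and conversely `R`
is contained in the local ring of every place other than `O`. Only the condition at `O` remains, and
it bounds the norm degree. -/
theorem mem_riemannRochSpace_single_zero [W.IsElliptic] {k : ℕ} {f : W.FunctionField} :
    f ∈ riemannRochSpace (Finsupp.single (placeAt (.zero : W.Point)) (k : ℤ)) ↔
      ∃ r ∈ poleSpace W k, algebraMap _ _ r = f := by
  have hzero : ∀ r : W.CoordinateRing, r ≠ 0 → (-(k : ℤ) ≤ (placeAt (.zero : W.Point)).ord
      (algebraMap _ _ r) ↔ r ∈ poleSpace W k) := by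
    intro r hr
    rw [Place.le_ord_iff _ (by simpa using hr), placeAt_zero_val, degVal_apply hr, mem_poleSpace]
    simp
  constructor
  · intro h
    by_cases hf : f = 0
    · exact ⟨0, Submodule.zero_mem _, by rw [hf, map_zero]⟩
    replace h := h hf
    obtain ⟨r, rfl⟩ := IsDedekindDomain.HeightOneSpectrum.mem_integers_of_valuation_le_one
      W.FunctionField f fun v => by
        have hv : placeOfPrime v ≠ placeAt (.zero : W.Point) := by
          intro hv
          have hx : xFun W ∉ (placeAt (.zero : W.Point)).ring := placeAt_isCenteredAt .zero
          rw [← hv] at hx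
          exact hx (v.valuation_le_one _)
        have h1 := h (placeOfPrime v)
        rw [Finsupp.single_eq_of_ne hv, Place.le_ord_iff _ hf] at h1
        have h2 : f ∈ (placeOfPrime v).ring :=
          (Place.val_le_one_iff _).mp (by simpa using h1)
        exact h2
    refine ⟨r, (hzero r (by rintro rfl; simp at hf)).mp ?_, rfl⟩
    simpa using h (placeAt .zero)
  · rintro ⟨r, hr, rfl⟩ hr0 P
    by_cases hP : P = placeAt (.zero : W.Point)
    · rw [hP, Finsupp.single_eq_same]
      exact (hzero r (by rintro rfl; simp at hr0)).mpr hr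
    · rw [Finsupp.single_eq_of_ne hP, Place.le_ord_iff _ hr0]
      simpa using P.val_le_one (coord_mem_of_ne_placeAt_zero hP r)

/-- Evaluation of functions in the affine coordinate ring at an affine rational point. -/
noncomputable def pointEval : {Q : W.Point // Q ≠ 0} → (W.CoordinateRing →ₐ[F] F)
  | ⟨.zero, h⟩ => absurd rfl h
  | ⟨.some _ _ h, _⟩ => (CoordinateRing.quotientXYIdealEquiv h.1).toAlgHom.comp
      (Ideal.Quotient.mkₐ F _)

theorem pointEval_some_eq_zero_iff {x y : F} {h : W.Nonsingular x y} (h0) {r : W.CoordinateRing} :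
    pointEval ⟨.some x y h, h0⟩ r = 0 ↔ r ∈ CoordinateRing.XYIdeal W x (C y) := by
  rw [← Ideal.Quotient.eq_zero_iff_mem]
  exact EmbeddingLike.map_eq_zero_iff (f := CoordinateRing.quotientXYIdealEquiv h.1)

theorem hasValue_placeAt_iff (Q : {Q : W.Point // Q ≠ 0}) (r : W.CoordinateRing) (c : F) :
    (placeAt Q.1).HasValue (algebraMap _ _ r) c ↔ pointEval Q r = c := by
  obtain ⟨_ | ⟨x, y, h⟩, h0⟩ := Q
  · exact absurd rfl h0
  obtain ⟨hx, hy⟩ := placeAt_isCenteredAt (.some x y h)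
  have hR : ∀ r : W.CoordinateRing, algebraMap _ W.FunctionField r ∈ (placeAt (.some x y h)).ring := by
    have hxm := add_mem (ValuationSubring.nonunits_subset hx) (Place.algebraMap_mem _ x)
    have hym := add_mem (ValuationSubring.nonunits_subset hy) (Place.algebraMap_mem _ y)
    exact Place.coord_mem _ (by simpa using hxm) (by simpa using hym)
  have hmem : ∀ s ∈ CoordinateRing.XYIdeal W x (C y),
      algebraMap _ W.FunctionField s ∈ (placeAt (.some x y h)).ring.nonunits := by
    intro s hs
    obtain ⟨a, b, rfl⟩ := Ideal.mem_span_pair.mp hs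
    rw [map_add, map_mul, map_mul]
    refine add_mem (Place.smul_mem_nonunits _ (hR a) ?_) (Place.smul_mem_nonunits _ (hR b) ?_)
    · convert hx using 1
      simp [xFun, CoordinateRing.XClass]; rfl
    · convert hy using 1
      simp [yFun, CoordinateRing.YClass]; rfl
  have hsub : algebraMap _ W.FunctionField r - algebraMap F _ c =
      algebraMap _ _ (r - algebraMap F _ c) := by
    rw [map_sub, ← IsScalarTower.algebraMap_apply]
  have hc : pointEval ⟨.some x y h, h0⟩ r - c =
      pointEval ⟨.some x y h, h0⟩ (r - algebraMap F _ c) := by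
    rw [map_sub, AlgHom.commutes, Algebra.algebraMap_self_apply]
  rw [Place.HasValue, hsub, ← sub_eq_zero, hc, pointEval_some_eq_zero_iff]
  refine ⟨fun hr => ?_, hmem _⟩
  -- The ideal of the point is maximal: if it did not contain `r`, then `1` would be a combination
  -- of `r` and one of its elements, hence a nonunit at the place.
  by_contra hrI
  obtain ⟨a, s, hs, hone⟩ := (XYIdeal_isMaximal h).exists_inv hrI
  have hone' := congr_arg (algebraMap _ W.FunctionField) hone
  rw [map_add, map_mul, map_one] at hone'
  have h1 : (1 : W.FunctionField) ∈ (placeAt (.some x y h)).ring.nonunits := by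
    rw [← hone']
    exact add_mem (Place.smul_mem_nonunits _ (hR a) hr) (hmem s hs)
  rw [ValuationSubring.mem_nonunits_iff, map_one] at h1
  exact lt_irrefl _ h1

theorem pointEval_X {x y : F} {h : W.Nonsingular x y} (h0) :
    pointEval ⟨.some x y h, h0⟩ (CoordinateRing.mk W (C X)) = x := by
  rw [← sub_eq_zero]
  have := (pointEval_some_eq_zero_iff h0 (r := CoordinateRing.XClass W x)).mpr
    (Ideal.subset_span (by simp))
  rw [CoordinateRing.XClass, map_sub, map_sub, map_sub] at this
  convert this using 2
  exact ((pointEval ⟨.some x y h, h0⟩).commutes x).symm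

theorem pointEval_Y {x y : F} {h : W.Nonsingular x y} (h0) :
    pointEval ⟨.some x y h, h0⟩ (CoordinateRing.mk W X) = y := by
  rw [← sub_eq_zero]
  have := (pointEval_some_eq_zero_iff h0 (r := CoordinateRing.YClass W (C y))).mpr
    (Ideal.subset_span (by simp))
  rw [CoordinateRing.YClass, map_sub, map_sub] at this
  convert this using 2
  exact ((pointEval ⟨.some x y h, h0⟩).commutes y).symm

theorem pointEval_injective : Function.Injective (pointEval (W := W)) := by
  rintro ⟨_ | ⟨x, y, h⟩, h0⟩ ⟨_ | ⟨x', y', h'⟩, h0'⟩ heq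
  any_goals exact absurd rfl ‹_›
  have hx := pointEval_X h0
  have hy := pointEval_Y h0
  rw [heq, pointEval_X] at hx
  rw [heq, pointEval_Y] at hy
  subst hx hy
  rfl

theorem mem_ellipticCode [W.IsElliptic] {n : ℕ} (P : Fin n → {Q : W.Point // Q ≠ 0}) {k : ℕ}
    {c : Fin n → F} : c ∈ ellipticCode W (fun i => (P i).1) k ↔
      ∃ r ∈ poleSpace W k, ∀ i, pointEval (P i) r = c i := by
  constructor
  · rintro ⟨f, hf, hc⟩
    obtain ⟨r, hr, rfl⟩ := mem_riemannRochSpace_single_zero.mp hf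
    exact ⟨r, hr, fun i => (hasValue_placeAt_iff _ _ _).mp (hc i)⟩
  · rintro ⟨r, hr, hc⟩
    exact ⟨_, mem_riemannRochSpace_single_zero.mpr ⟨r, hr, rfl⟩,
      fun i => (hasValue_placeAt_iff _ _ _).mpr (hc i)⟩

end Places

/-! ### Counting zeros, principal ideals and zero sums, interpolation at rational points. -/

section Interpolation

variable {F : Type*} [Field F] {W : WeierstrassCurve.Affine F}

/-! ### Dimension of the pole spaces -/

variable (W) in
/-- The map `(p, q) ↦ p + q y` on polynomials of bounded degree whose range is `poleSpace W k`. -/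
noncomputable def poleSpaceParam (k : ℕ) :
    degreeLT F (k / 2 + 1) × degreeLT F ((k - 1) / 2) →ₗ[F] W.CoordinateRing :=
  ((LinearMap.toSpanSingleton F[X] W.CoordinateRing 1).restrictScalars F ∘ₗ
      (degreeLT F (k / 2 + 1)).subtype).coprod
    ((LinearMap.toSpanSingleton F[X] W.CoordinateRing (CoordinateRing.mk W X)).restrictScalars F ∘ₗ
      (degreeLT F ((k - 1) / 2)).subtype)

theorem poleSpaceParam_injective (k : ℕ) : Function.Injective (poleSpaceParam W k) := by
  rw [← LinearMap.ker_eq_bot, LinearMap.ker_eq_bot']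
  rintro ⟨p, q⟩ h
  obtain ⟨hp, hq⟩ := CoordinateRing.smul_basis_eq_zero h
  exact Prod.ext (Subtype.ext hp) (Subtype.ext hq)

/-- The norm of `p + q y` has degree `max (2 deg p) (2 deg q + 3)`, so the bound `k` splits into
separate bounds on `p` and `q`. For `k ≤ 2` the second one forces `q = 0`, in agreement with the
truncated `(k - 1) / 2`. -/
theorem range_poleSpaceParam (k : ℕ) : (poleSpaceParam W k).range = poleSpace W k := by
  have key : ∀ p q : F[X], (p • (1 : W.CoordinateRing) + q • CoordinateRing.mk W X ∈ poleSpace W k ↔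
      p ∈ degreeLT F (k / 2 + 1) ∧ q ∈ degreeLT F ((k - 1) / 2)) := by
    intro p q
    rw [mem_poleSpace, natDegree_le_iff_degree_le, CoordinateRing.degree_norm_smul_basis, max_le_iff,
      mem_degreeLT, mem_degreeLT]
    refine and_congr ?_ ?_
    · by_cases hp : p = 0
      · simp [hp]
      · rw [degree_eq_natDegree hp, show 2 • (p.natDegree : WithBot ℕ) =
          ((2 * p.natDegree : ℕ) : WithBot ℕ) by simp, Nat.cast_le, Nat.cast_lt]
        omega
    · by_cases hq : q = 0
      · simp [hq]
      · rw [degree_eq_natDegree hq, show 2 • (q.natDegree : WithBot ℕ) + 3 =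
          ((2 * q.natDegree + 3 : ℕ) : WithBot ℕ) by simp, Nat.cast_le, Nat.cast_lt]
        omega
  ext r
  constructor
  · rintro ⟨⟨p, q⟩, rfl⟩
    exact (key _ _).mpr ⟨p.2, q.2⟩
  · intro hr
    obtain ⟨p, q, rfl⟩ := CoordinateRing.exists_smul_basis_eq r
    obtain ⟨hp, hq⟩ := (key p q).mp hr
    exact ⟨⟨⟨p, hp⟩, ⟨q, hq⟩⟩, rfl⟩

instance (n : ℕ) : FiniteDimensional F (degreeLT F n) := .equiv (degreeLTEquiv F n).symm

instance (k : ℕ) : FiniteDimensional F (poleSpace W k) := by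
  rw [← range_poleSpaceParam]; infer_instance

/-- The count is `(k / 2 + 1) + (k - 1) / 2`, which equals `k` for `k ≥ 1`; for `k = 0` the
constants would give dimension `1`. -/
theorem finrank_poleSpace {k : ℕ} (hk : 1 ≤ k) : Module.finrank F (poleSpace W k) = k := by
  rw [← range_poleSpaceParam, LinearMap.finrank_range_of_inj (poleSpaceParam_injective k),
    Module.finrank_prod, (degreeLTEquiv F _).finrank_eq, (degreeLTEquiv F _).finrank_eq,
    Module.finrank_fin_fun, Module.finrank_fin_fun]
  omega

/-! ### Functions vanishing at rational points -/

/-- Simultaneous evaluation at a finite set of affine rational points. -/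
noncomputable def evalOn (S : Finset {Q : W.Point // Q ≠ 0}) : W.CoordinateRing →ₗ[F] (S → F) :=
  LinearMap.pi fun Q => (pointEval Q.1).toLinearMap

@[simp]
theorem evalOn_apply (S : Finset {Q : W.Point // Q ≠ 0}) (r : W.CoordinateRing) (Q : S) :
    evalOn S r Q = pointEval Q.1 r := rfl

theorem ker_pointEval_isMaximal (Q : {Q : W.Point // Q ≠ 0}) :
    (RingHom.ker (pointEval Q)).IsMaximal :=
  RingHom.ker_isMaximal_of_surjective _ fun c => ⟨algebraMap F _ c, (pointEval Q).commutes c⟩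

theorem ker_pointEval_isCoprime {Q Q' : {Q : W.Point // Q ≠ 0}} (h : Q ≠ Q') :
    IsCoprime (RingHom.ker (pointEval Q)) (RingHom.ker (pointEval Q')) := by
  have := ker_pointEval_isMaximal Q
  have := ker_pointEval_isMaximal Q'
  refine Ideal.isCoprime_of_isMaximal fun heq => h (pointEval_injective (AlgHom.ext fun r => ?_))
  have hr : r - algebraMap F _ (pointEval Q r) ∈ RingHom.ker (pointEval Q) := by
    rw [RingHom.mem_ker, map_sub, AlgHom.commutes, Algebra.algebraMap_self_apply, sub_self]
  rw [heq, RingHom.mem_ker, map_sub, AlgHom.commutes, Algebra.algebraMap_self_apply,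
    sub_eq_zero] at hr
  exact hr.symm

theorem evalOn_surjective (S : Finset {Q : W.Point // Q ≠ 0}) :
    Function.Surjective (evalOn S) := by
  intro c
  obtain ⟨r, hr⟩ := Ideal.exists_forall_sub_mem_ideal
    (I := fun Q : S => RingHom.ker (pointEval Q.1))
    (fun Q Q' h => ker_pointEval_isCoprime fun h' => h (Subtype.ext h'))
    (fun Q => algebraMap F _ (c Q))
  refine ⟨r, funext fun Q => ?_⟩
  have := hr Q
  rwa [RingHom.mem_ker, map_sub, AlgHom.commutes, Algebra.algebraMap_self_apply,
    sub_eq_zero] at this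

theorem finiteDimensional_quotient_span_singleton {f : W.CoordinateRing} (hf : f ≠ 0) :
    FiniteDimensional F (W.CoordinateRing ⧸ Ideal.span {f}) :=
  .equiv (Ideal.quotientEquivDirectSum F (CoordinateRing.basis W)
    (Ideal.span_singleton_eq_bot.not.mpr hf)).symm

/-- Simultaneous evaluation on the quotient by a function vanishing at all the points. -/
noncomputable def evalOnQuotient (S : Finset {Q : W.Point // Q ≠ 0}) {f : W.CoordinateRing}
    (hS : ∀ Q ∈ S, pointEval Q f = 0) : (W.CoordinateRing ⧸ Ideal.span {f}) →ₗ[F] (S → F) :=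
  ((Ideal.span {f}).restrictScalars F).liftQ (evalOn S) fun r hr => by
    obtain ⟨a, rfl⟩ := Ideal.mem_span_singleton'.mp hr
    exact funext fun Q => by simp [hS Q.1 Q.2]

theorem evalOnQuotient_surjective (S : Finset {Q : W.Point // Q ≠ 0}) {f : W.CoordinateRing}
    (hS : ∀ Q ∈ S, pointEval Q f = 0) : Function.Surjective (evalOnQuotient S hS) := by
  intro c
  obtain ⟨r, rfl⟩ := evalOn_surjective S c
  exact ⟨Ideal.Quotient.mk _ r, rfl⟩

/-- Evaluation at `S` factors through `R/(f)`, whose dimension is the norm degree, and it is onto.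
-/
theorem card_le_natDegree_norm (S : Finset {Q : W.Point // Q ≠ 0}) {f : W.CoordinateRing}
    (hf : f ≠ 0) (hS : ∀ Q ∈ S, pointEval Q f = 0) :
    S.card ≤ (Algebra.norm F[X] f).natDegree := by
  have := finiteDimensional_quotient_span_singleton hf
  have h := LinearMap.finrank_le_finrank_of_surjective (evalOnQuotient_surjective S hS)
  rwa [Module.finrank_fintype_fun_eq_card, Fintype.card_coe,
    finrank_quotient_span_eq_natDegree_norm (CoordinateRing.basis W) hf] at h

/-- With equal dimensions the surjection from `R/(f)` to `F^S` is injective, so a function vanishing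
on `S` is zero modulo `f`. -/
theorem dvd_of_natDegree_norm_eq_card (S : Finset {Q : W.Point // Q ≠ 0}) {f g : W.CoordinateRing}
    (hf : f ≠ 0) (hS : ∀ Q ∈ S, pointEval Q f = 0)
    (hcard : (Algebra.norm F[X] f).natDegree = S.card) (hg : ∀ Q ∈ S, pointEval Q g = 0) :
    f ∣ g := by
  have := finiteDimensional_quotient_span_singleton hf
  have hinj : Function.Injective (evalOnQuotient S hS) := by
    rw [LinearMap.injective_iff_surjective_of_finrank_eq_finrank]
    · exact evalOnQuotient_surjective S hS
    · rw [Module.finrank_fintype_fun_eq_card, Fintype.card_coe,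
        finrank_quotient_span_eq_natDegree_norm (CoordinateRing.basis W) hf, hcard]
  rw [← Ideal.mem_span_singleton, ← Ideal.Quotient.eq_zero_iff_mem]
  apply hinj
  rw [map_zero]
  exact funext fun Q => hg Q.1 Q.2

theorem mem_prod_ker_pointEval (S : Finset {Q : W.Point // Q ≠ 0}) {g : W.CoordinateRing} :
    g ∈ ∏ Q ∈ S, RingHom.ker (pointEval Q) ↔ ∀ Q ∈ S, pointEval Q g = 0 := by
  rw [Ideal.prod_eq_iInf_of_pairwise_isCoprime fun Q _ Q' _ h => ker_pointEval_isCoprime h]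
  simp

/-- Here `(f)` is the full ideal of functions vanishing on `S`, so `R/(f)` is isomorphic to `F^S`.
-/
theorem natDegree_norm_of_span_eq_prod (S : Finset {Q : W.Point // Q ≠ 0}) {f : W.CoordinateRing}
    (hf : f ≠ 0) (h : ∏ Q ∈ S, RingHom.ker (pointEval Q) = Ideal.span {f}) :
    (Algebra.norm F[X] f).natDegree = S.card := by
  have hS : ∀ Q ∈ S, pointEval Q f = 0 := by
    rw [← mem_prod_ker_pointEval, h]
    exact Ideal.mem_span_singleton_self f
  have hinj : Function.Injective (evalOnQuotient S hS) := by
    rw [← LinearMap.ker_eq_bot, LinearMap.ker_eq_bot']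
    intro r hr
    obtain ⟨r, rfl⟩ := Ideal.Quotient.mk_surjective r
    rw [Ideal.Quotient.eq_zero_iff_mem, ← h, mem_prod_ker_pointEval]
    exact fun Q hQ => congr_fun hr ⟨Q, hQ⟩
  have := (LinearEquiv.ofBijective _ ⟨hinj, evalOnQuotient_surjective S hS⟩).finrank_eq
  rwa [Module.finrank_fintype_fun_eq_card, Fintype.card_coe,
    finrank_quotient_span_eq_natDegree_norm (CoordinateRing.basis W) hf] at this

/-- `Point.toClass` is a homomorphism sending an affine point to the class of its maximal ideal, so
sums of points become products of ideals. -/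
theorem exists_toClass_sum_eq_mk [DecidableEq F] (S : Finset {Q : W.Point // Q ≠ 0}) :
    ∃ u : (FractionalIdeal (nonZeroDivisors W.CoordinateRing) W.FunctionField)ˣ,
      (u : FractionalIdeal (nonZeroDivisors W.CoordinateRing) W.FunctionField) =
        (∏ Q ∈ S, RingHom.ker (pointEval Q) : Ideal W.CoordinateRing) ∧
      Point.toClass (∑ Q ∈ S, Q.1) = Additive.ofMul (ClassGroup.mk W.FunctionField u) := by
  classical
  induction S using Finset.induction_on with
  | empty => exact ⟨1, by simp, by simp⟩
  | insert Q S hQ ih =>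
    obtain ⟨u, hu, hS⟩ := ih
    obtain ⟨_ | ⟨x, y, h⟩, h0⟩ := Q
    · exact absurd rfl h0
    refine ⟨CoordinateRing.XYIdeal' h * u, ?_, ?_⟩
    · rw [Finset.prod_insert hQ, Units.val_mul, hu, FractionalIdeal.coeIdeal_mul,
        CoordinateRing.XYIdeal'_eq]
      congr 2
      ext r
      exact (pointEval_some_eq_zero_iff h0).symm
    · rw [Finset.sum_insert hQ, map_add, hS, map_mul, ofMul_mul]
      rfl

/-- Distinct nonzero rational points sum to zero if and only if they are zeros of a function whose
only pole is at infinity and has order equal to their number. -/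
theorem sum_eq_zero_iff_exists [DecidableEq F] (S : Finset {Q : W.Point // Q ≠ 0}) :
    ∑ Q ∈ S, Q.1 = 0 ↔ ∃ f ∈ poleSpace W S.card, f ≠ 0 ∧ ∀ Q ∈ S, pointEval Q f = 0 := by
  obtain ⟨u, hu, hS⟩ := exists_toClass_sum_eq_mk S
  -- Injectivity of `Point.toClass` turns the zero sum into principality of the product of the
  -- maximal ideals.
  rw [← Point.toClass_eq_zero, hS, ofMul_eq_zero, ClassGroup.mk_eq_one_of_coe_ideal hu]
  constructor
  · rintro ⟨f, hf, h⟩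
    refine ⟨f, (natDegree_norm_of_span_eq_prod S hf h).le, hf, ?_⟩
    rw [← mem_prod_ker_pointEval, h]
    exact Ideal.mem_span_singleton_self f
  · rintro ⟨f, hfd, hf, h⟩
    refine ⟨f, hf, le_antisymm (fun g hg => ?_) ?_⟩
    · rw [Ideal.mem_span_singleton]
      exact dvd_of_natDegree_norm_eq_card S hf h (le_antisymm hfd (card_le_natDegree_norm S hf h))
        ((mem_prod_ker_pointEval S).mp hg)
    · rwa [Ideal.span_singleton_le_iff_mem, mem_prod_ker_pointEval]

/-! ### Interpolation -/

theorem le_finrank_poleSpace_inf_ker (S : Finset {Q : W.Point // Q ≠ 0}) {k : ℕ} (hk : 1 ≤ k) :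
    k ≤ Module.finrank F (poleSpace W k ⊓ (evalOn S).ker : Submodule F W.CoordinateRing) + S.card := by
  have h1 := ((evalOn S).domRestrict (poleSpace W k)).finrank_range_add_finrank_ker
  have h2 := Submodule.finrank_le ((evalOn S).domRestrict (poleSpace W k)).range
  rw [Module.finrank_fintype_fun_eq_card, Fintype.card_coe] at h2
  rw [finrank_poleSpace hk] at h1
  have h3 : Module.finrank F ((evalOn S).domRestrict (poleSpace W k)).ker =
      Module.finrank F (poleSpace W k ⊓ (evalOn S).ker : Submodule F W.CoordinateRing) := by
    rw [LinearMap.ker_domRestrict, ← Submodule.map_comap_subtype, Submodule.finrank_map_subtype_eq]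
  omega

theorem exists_mem_poleSpace_of_card_lt (S : Finset {Q : W.Point // Q ≠ 0}) {k : ℕ}
    (hk : S.card < k) : ∃ f ∈ poleSpace W k, f ≠ 0 ∧ ∀ Q ∈ S, pointEval Q f = 0 := by
  have h := le_finrank_poleSpace_inf_ker S (k := k) (by omega)
  obtain ⟨f, hf, hf0⟩ := Submodule.exists_mem_ne_zero_of_ne_bot
    (p := poleSpace W k ⊓ (evalOn S).ker) (by rintro h0; rw [h0, finrank_bot] at h; omega)
  exact ⟨f, hf.1, hf0, fun Q hQ => congr_fun hf.2 ⟨Q, hQ⟩⟩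

/-- Functions with a pole of order at most `k` at infinity separate a point from fewer than `k - 1`
other points. -/
theorem exists_mem_poleSpace_eval_ne_zero (S : Finset {Q : W.Point // Q ≠ 0}) {k : ℕ}
    (hk : S.card + 2 ≤ k) {Q : {Q : W.Point // Q ≠ 0}} (hQ : Q ∉ S) :
    ∃ f ∈ poleSpace W k, (∀ Q ∈ S, pointEval Q f = 0) ∧ pointEval Q f ≠ 0 := by
  classical
  by_contra! hcon
  -- If separation fails, this `f` with pole order at most `|S| + 1` vanishes at the `|S| + 1`
  -- points of `S ∪ {Q}`, so these zeros exhaust its norm degree.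
  obtain ⟨f, hf, hf0, hfS⟩ := exists_mem_poleSpace_of_card_lt S (Nat.lt_succ_self S.card)
  have hins : ∀ g ∈ poleSpace W (S.card + 2), (∀ R ∈ S, pointEval R g = 0) →
      ∀ R ∈ insert Q S, pointEval R g = 0 := fun g hg hgS =>
    Finset.forall_mem_insert _ _ _ |>.mpr ⟨hcon g (hg.trans hk) hgS, hgS⟩
  have hfI := hins f (hf.trans (Nat.le_succ _)) hfS
  have hcard : (Algebra.norm F[X] f).natDegree = (insert Q S).card := by
    refine le_antisymm ?_ (card_le_natDegree_norm _ hf0 hfI)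
    rw [Finset.card_insert_of_notMem hQ]
    exact hf
  -- Every function in `L((|S| + 2)O)` vanishing on `S` is then `f` times an element of `L(O)`, a
  -- space of dimension `1`; but such functions form a space of dimension at least `2`.
  have hle : (poleSpace W (S.card + 2) ⊓ (evalOn S).ker : Submodule F W.CoordinateRing) ≤
      (poleSpace W 1).map (LinearMap.mulLeft F f) := by
    rintro g ⟨hg, hgS⟩
    obtain ⟨h, rfl⟩ := dvd_of_natDegree_norm_eq_card _ hf0 hfI hcard
      (hins g hg fun R hR => congr_fun hgS ⟨R, hR⟩)
    refine ⟨h, ?_, rfl⟩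
    by_cases hh : h = 0
    · rw [hh]; exact Submodule.zero_mem _
    have hg' : (Algebra.norm F[X] (f * h)).natDegree ≤ S.card + 2 := hg
    rw [map_mul, natDegree_mul (norm_ne hf0) (norm_ne hh), hcard,
      Finset.card_insert_of_notMem hQ] at hg'
    change (Algebra.norm F[X] h).natDegree ≤ 1
    omega
  have h1 := Submodule.finrank_mono hle
  have h2 := Submodule.finrank_map_le (LinearMap.mulLeft F f) (poleSpace W 1)
  rw [finrank_poleSpace le_rfl] at h2
  have h3 := le_finrank_poleSpace_inf_ker S (k := S.card + 2) (by omega)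
  omega

end Interpolation

/-! ### Linear codes -/

section Codes
variable {F : Type*} [Field F] {n : ℕ} {C : Submodule F (Fin n → F)}

theorem dualCode_eq_comap (C : Submodule F (Fin n → F)) :
    dualCode C = C.dualAnnihilator.comap (dotProductEquiv F (Fin n)).toLinearMap := by
  ext w
  simp only [Submodule.mem_comap, Submodule.mem_dualAnnihilator]
  refine forall₂_congr fun c _ => ?_
  change ∑ i, c i * w i = 0 ↔ ∑ i, w i * c i = 0
  simp_rw [mul_comm]

theorem finrank_add_finrank_dualCode (C : Submodule F (Fin n → F)) :
    Module.finrank F C + Module.finrank F (dualCode C) = n := by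
  rw [dualCode_eq_comap, (LinearEquiv.ofSubmodule' (dotProductEquiv F (Fin n)) _).finrank_eq,
    Subspace.finrank_add_finrank_dualAnnihilator_eq, Module.finrank_fin_fun]

/-- If a nonzero word of `C` vanishes on a set of at least `dim C` coordinates, then some nonzero
word of the dual code is supported there. -/
theorem exists_mem_dualCode (S : Finset (Fin n)) (hS : Module.finrank F C ≤ S.card)
    {c : Fin n → F} (hc : c ∈ C) (h0 : c ≠ 0) (hcS : ∀ i ∈ S, c i = 0) :
    ∃ w ∈ dualCode C, w ≠ 0 ∧ ∀ i ∉ S, w i = 0 := by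
  let Z : Submodule F (Fin n → F) := (LinearMap.funLeft F F (Subtype.val : S → Fin n)).ker
  have hcZ : c ∈ Z := LinearMap.mem_ker.mpr (funext fun i => hcS i.1 i.2)
  have hZ : Module.finrank F Z + S.card = n := by
    have h := (LinearMap.funLeft F F (Subtype.val : S → Fin n)).finrank_range_add_finrank_ker
    rw [LinearMap.range_eq_top.mpr
      (LinearMap.funLeft_surjective_of_injective F F _ Subtype.val_injective), finrank_top,
      Module.finrank_fintype_fun_eq_card, Fintype.card_coe, Module.finrank_fin_fun] at h
    rw [add_comm]; exact h
  -- `Z` consists of the words vanishing on `S` and meets `C` nontrivially, so `dim (C + Z) < dim C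
  -- + (n - |S|) ≤ n`. A nonzero functional killing `C + Z` is a dual word, and killing `Z` puts its
  -- support inside `S`.
  have hlt : C ⊔ Z < ⊤ := by
    rw [lt_top_iff_ne_top]
    intro htop
    have h := Submodule.finrank_sup_add_finrank_inf_eq C Z
    rw [htop, finrank_top, Module.finrank_fin_fun] at h
    have hpos : 0 < Module.finrank F (C ⊓ Z : Submodule F (Fin n → F)) := by
      rw [Module.finrank_pos_iff, Submodule.nontrivial_iff_ne_bot]
      exact fun hb => h0 ((Submodule.mem_bot F).mp (hb ▸ Submodule.mem_inf.mpr ⟨hc, hcZ⟩))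
    omega
  obtain ⟨φ, hφ0, hφ⟩ := Submodule.exists_le_ker_of_lt_top _ hlt
  obtain ⟨w, rfl⟩ := (dotProductEquiv F (Fin n)).surjective φ
  refine ⟨w, ?_, ?_, fun i hi => ?_⟩
  · rw [dualCode_eq_comap, Submodule.mem_comap, Submodule.mem_dualAnnihilator]
    exact fun d hd => hφ (Submodule.mem_sup_left hd)
  · rintro rfl
    exact hφ0 (map_zero _)
  · have h : Pi.single i 1 ∈ Z := LinearMap.mem_ker.mpr (funext fun j => by
      have : (j : Fin n) ≠ i := fun h => hi (h ▸ j.2)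
      simp [LinearMap.funLeft_apply, this])
    simpa using hφ (Submodule.mem_sup_right h)

variable [DecidableEq F]

theorem minDist_le {c : Fin n → F} (hc : c ∈ C) (h0 : c ≠ 0) : minDist C ≤ hammingNorm c :=
  Nat.sInf_le ⟨c, hc, h0, rfl⟩

theorem exists_hammingNorm_eq_minDist (hC : C ≠ ⊥) :
    ∃ c ∈ C, c ≠ 0 ∧ hammingNorm c = minDist C := by
  obtain ⟨c, hc, h0⟩ := Submodule.exists_mem_ne_zero_of_ne_bot hC
  exact Nat.sInf_mem (s := {d | ∃ c ∈ C, c ≠ 0 ∧ hammingNorm c = d}) ⟨_, c, hc, h0, rfl⟩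

theorem card_wordSupport (c : Fin n → F) : (wordSupport c).card = hammingNorm c := rfl

theorem mem_wordSupport {c : Fin n → F} {i : Fin n} : i ∈ wordSupport c ↔ c i ≠ 0 := by
  simp [wordSupport]

theorem card_compl_wordSupport_add (c : Fin n → F) :
    (wordSupport c)ᶜ.card + hammingNorm c = n := by
  rw [← card_wordSupport, Finset.card_compl_add_card, Fintype.card_fin]

end Codes

/-! ### Designs -/

section Designs
variable {α : Type*}

section Counting
variable [Fintype α] [DecidableEq α] {𝓑 : Finset (Finset α)} {t k l : ℕ}

/-- A `t`-design is a `j`-design for `j ≤ t`: counting the pairs `(x, B)` with `x ∉ T` and `T ∪ {x}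
⊆ B` in two ways gives `(v - j) λ_{j+1} = (k - j) λ_j`. -/
theorem exists_card_filter_subset (hk : ∀ B ∈ 𝓑, B.card = k) (ht : t ≤ k)
    (h : ∀ T : Finset α, T.card = t → (𝓑.filter (T ⊆ ·)).card = l) {j : ℕ} (hj : j ≤ t) :
    ∃ m, ∀ T : Finset α, T.card = j → (𝓑.filter (T ⊆ ·)).card = m := by
  induction hj using Nat.decreasingInduction with
  | self => exact ⟨l, h⟩
  | of_succ j hj ih =>
    obtain ⟨m, hm⟩ := ih
    refine ⟨(Fintype.card α - j) * m / (k - j), fun T hT => ?_⟩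
    have hcount : ∑ x ∈ Tᶜ, (𝓑.filter (insert x T ⊆ ·)).card =
        ∑ B ∈ 𝓑.filter (T ⊆ ·), (Tᶜ.filter (· ∈ B)).card := by
      simp_rw [Finset.card_filter, Finset.sum_filter]
      rw [Finset.sum_comm]
      refine Finset.sum_congr rfl fun B _ => ?_
      by_cases hTB : T ⊆ B
      · simp [hTB, Finset.insert_subset_iff]
      · simp [hTB, Finset.insert_subset_iff]
    have h1 : ∀ x ∈ Tᶜ, (𝓑.filter (insert x T ⊆ ·)).card = m := fun x hx =>
      hm _ (by rw [Finset.card_insert_of_notMem (Finset.mem_compl.mp hx), hT])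
    have h2 : ∀ B ∈ 𝓑.filter (T ⊆ ·), (Tᶜ.filter (· ∈ B)).card = k - j := by
      intro B hB
      rw [Finset.mem_filter] at hB
      rw [← hk B hB.1, ← hT, ← Finset.card_sdiff_of_subset hB.2]
      congr 1
      ext x
      simp [and_comm]
    rw [Finset.sum_const_nat h1, Finset.sum_const_nat h2, Finset.card_compl, hT] at hcount
    rw [hcount, Nat.mul_div_cancel _ (by omega)]

/-- Induction on `|D|`: the blocks that contain `A` and avoid `D ∪ {x}` are those that contain `A`
and avoid `D`, minus those among them containing `x`. -/
theorem exists_card_filter_subset_disjoint (hk : ∀ B ∈ 𝓑, B.card = k) (ht : t ≤ k)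
    (h : ∀ T : Finset α, T.card = t → (𝓑.filter (T ⊆ ·)).card = l) (d : ℕ) :
    ∀ a, a + d ≤ t → ∃ m, ∀ A D : Finset α, A.card = a → D.card = d → Disjoint A D →
      (𝓑.filter fun B => A ⊆ B ∧ Disjoint D B).card = m := by
  induction d with
  | zero =>
    intro a ha
    obtain ⟨m, hm⟩ := exists_card_filter_subset hk ht h (j := a) (by omega)
    refine ⟨m, fun A D hA hD _ => ?_⟩
    rw [Finset.card_eq_zero.mp hD]
    simpa using hm A hA
  | succ d ih =>
    intro a ha
    obtain ⟨m₁, h₁⟩ := ih a (by omega)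
    obtain ⟨m₂, h₂⟩ := ih (a + 1) (by omega)
    refine ⟨m₁ - m₂, fun A D hA hD hAD => ?_⟩
    obtain ⟨x, D, hx, rfl, hD'⟩ := Finset.card_eq_succ.mp hD
    rw [Finset.disjoint_insert_right] at hAD
    rw [← h₁ A D hA hD' hAD.2, ← h₂ (insert x A) D (by rw [Finset.card_insert_of_notMem hAD.1, hA])
      hD' (Finset.disjoint_insert_left.mpr ⟨hx, hAD.2⟩)]
    rw [eq_tsub_iff_add_eq_of_le (Finset.card_le_card fun B => by
      simp only [Finset.mem_filter, Finset.insert_subset_iff]; tauto), ← Finset.card_union_of_disjoint]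
    · congr 1
      ext B
      simp only [Finset.mem_union, Finset.mem_filter, Finset.insert_subset_iff,
        Finset.disjoint_insert_left]
      tauto
    · rw [Finset.disjoint_filter]
      simp only [Finset.insert_subset_iff, Finset.disjoint_insert_left]
      tauto

end Counting

theorem IsDesign.nonempty [Finite α] {V : Set α} {𝓑 : Set (Finset α)} {t k l : ℕ}
    (h : IsDesign V 𝓑 t k l) : 𝓑.Nonempty := by
  obtain ⟨T, hTV, hT⟩ := Set.exists_subset_card_eq (h.t_le.trans h.le_card)
  have hcount := h.count T.toFinite.toFinset (by simpa using hTV)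
    (by rw [← Set.ncard_eq_toFinset_card, hT])
  have hne : {B ∈ 𝓑 | T.toFinite.toFinset ⊆ B}.Nonempty :=
    Set.nonempty_of_ncard_ne_zero (by rw [hcount]; exact Nat.one_le_iff_ne_zero.mp h.pos)
  exact hne.mono fun B hB => hB.1

/-- The complements of the blocks of a `t`-design form a `t`-design, unless the blocks are all the
subsets of their size. -/
theorem IsTDesign.compl [Fintype α] [DecidableEq α] {𝓑 : Set (Finset α)} {t k : ℕ} (h : IsTDesign Set.univ 𝓑 t)
    (hk : ∀ B ∈ 𝓑, B.card = k) (hne : ∃ B : Finset α, B.card = k ∧ B ∉ 𝓑) :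
    IsTDesign Set.univ {B | Bᶜ ∈ 𝓑} t := by
  classical
  obtain ⟨s, l, h⟩ := h
  obtain ⟨B₁, hB₁⟩ := h.nonempty
  obtain rfl : k = s := (hk _ hB₁).symm.trans (h.block_card _ hB₁)
  obtain ⟨𝓕, rfl⟩ : ∃ 𝓕 : Finset (Finset α), (𝓕 : Set (Finset α)) = 𝓑 :=
    ⟨𝓑.toFinite.toFinset, by simp⟩
  have hcount : ∀ T : Finset α, T.card = t → (𝓕.filter (T ⊆ ·)).card = l := by
    intro T hT
    rw [← h.count T (Set.subset_univ _) hT, ← Set.ncard_coe_finset]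
    congr 1
    ext B
    simp
  have hcompl : ∀ T : Finset α, {B | B ∈ {B : Finset α | Bᶜ ∈ (𝓕 : Set (Finset α))} ∧ T ⊆ B}.ncard =
      (𝓕.filter fun B => ∅ ⊆ B ∧ Disjoint T B).card := by
    intro T
    rw [← Set.ncard_coe_finset, ← Set.ncard_image_of_injective _ compl_injective]
    congr 1
    ext B
    simp only [Set.mem_image, Set.mem_ofPred_eq, Finset.coe_filter, Finset.empty_subset, true_and,
      Finset.mem_coe]
    constructor
    · rintro ⟨B, ⟨hB, hT⟩, rfl⟩
      exact ⟨hB, disjoint_compl_right_iff.mpr hT⟩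
    · rintro ⟨hB, hT⟩
      exact ⟨Bᶜ, ⟨by rwa [compl_compl], le_compl_iff_disjoint_right.mpr hT⟩, compl_compl B⟩
  have hconst : ∀ d ≤ t, ∃ m, ∀ D : Finset α, D.card = d →
      (𝓕.filter fun B => ∅ ⊆ B ∧ Disjoint D B).card = m := by
    intro d hd
    obtain ⟨m, hm⟩ := exists_card_filter_subset_disjoint hk h.t_le hcount d 0 (by omega)
    exact ⟨m, fun D hD => hm ∅ D rfl hD (Finset.disjoint_empty_left D)⟩
  have hkα : k ≤ Fintype.card α := hk _ hB₁ ▸ Finset.card_le_univ B₁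
  -- If `t` does not exceed the complementary block size `v - k`, a `t`-subset of the complement of
  -- a block shows that the new index is positive.
  rcases le_or_gt t (Fintype.card α - k) with hle | hlt
  · obtain ⟨m, hm⟩ := hconst t le_rfl
    refine ⟨Fintype.card α - k, m, hle, ?_, ?_, fun _ _ => Set.subset_univ _, ?_, ?_⟩
    · rw [Set.ncard_univ, Nat.card_eq_fintype_card]
      exact Nat.sub_le _ _
    · obtain ⟨T, hT, hTt⟩ := Finset.exists_subset_card_eq
        (show t ≤ B₁ᶜ.card by rwa [Finset.card_compl, hk _ hB₁])
      rw [← hm T hTt, Nat.one_le_iff_ne_zero, Finset.card_ne_zero]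
      exact ⟨B₁, Finset.mem_filter.mpr ⟨hB₁, Finset.empty_subset _, le_compl_iff_disjoint_right.mp hT⟩⟩
    · intro B hB
      have := hk _ hB
      rw [Finset.card_compl] at this
      have := Finset.card_le_univ B
      omega
    · intro T _ hT
      rw [← hm T hT]
      exact hcompl T
  -- For `|D| = v - k` only the block `Dᶜ` can avoid `D`. Constancy of the count means that all
  -- `k`-sets are blocks or none is, and `hne` excludes the first.
  · obtain ⟨m, hm⟩ := hconst (Fintype.card α - k) hlt.le
    obtain ⟨B₂, hB₂, hB₂'⟩ := hne
    have hcard : ∀ B : Finset α, B.card = k → Bᶜ.card = Fintype.card α - k := fun B hB => by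
      rw [Finset.card_compl, hB]
    have h1 := hm _ (hcard _ (hk _ hB₁))
    rw [← hm _ (hcard _ hB₂)] at h1
    have h2 : (𝓕.filter fun B => ∅ ⊆ B ∧ Disjoint B₁ᶜ B).card ≠ 0 :=
      Finset.card_ne_zero.mpr ⟨B₁, Finset.mem_filter.mpr
        ⟨hB₁, Finset.empty_subset _, disjoint_compl_left⟩⟩
    rw [h1, Finset.card_ne_zero] at h2
    obtain ⟨B, hB⟩ := h2
    rw [Finset.mem_filter] at hB
    have hsub : B ⊆ B₂ := disjoint_compl_left_iff.mp hB.2.2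
    exact absurd (Finset.eq_of_subset_of_card_le hsub (by rw [hB₂, hk _ hB.1]) ▸ hB.1) hB₂'

theorem isTDesign_compl_iff [Fintype α] [DecidableEq α] {𝓑 : Set (Finset α)} {t k : ℕ}
    (hk : ∀ B ∈ 𝓑, B.card = k) (hne : ∃ B : Finset α, B.card = k ∧ B ∉ 𝓑) :
    IsTDesign Set.univ {B | Bᶜ ∈ 𝓑} t ↔ IsTDesign Set.univ 𝓑 t := by
  refine ⟨fun h => ?_, fun h => h.compl hk hne⟩
  obtain ⟨B, hB, hB'⟩ := hne
  have := h.compl (k := Fintype.card α - k) (fun B hB => ?_) ⟨Bᶜ, ?_, ?_⟩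
  · simpa using this
  · have h1 := hk _ hB
    rw [Finset.card_compl] at h1
    have := Finset.card_le_univ B
    omega
  · rw [Finset.card_compl, hB]
  · simpa using hB'

theorem isDesign_image_map_iff {β : Type*} (e : α ↪ β) {𝓑 : Set (Finset α)}
    {t k l : ℕ} : IsDesign (Set.range e) (Finset.map e '' 𝓑) t k l ↔ IsDesign Set.univ 𝓑 t k l := by
  classical
  have hcard : (Set.range e).ncard = (Set.univ : Set α).ncard := by
    rw [← Set.image_univ, Set.ncard_image_of_injective _ e.injective]
  have hcount : ∀ T : Finset α, {B ∈ Finset.map e '' 𝓑 | T.map e ⊆ B}.ncard =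
      {B ∈ 𝓑 | T ⊆ B}.ncard := by
    intro T
    rw [← Set.ncard_image_of_injective _ (Finset.map_injective e)]
    congr 1
    ext B
    constructor
    · rintro ⟨⟨B, hB, rfl⟩, hT⟩
      exact ⟨B, ⟨hB, Finset.map_subset_map.mp hT⟩, rfl⟩
    · rintro ⟨B, ⟨hB, hT⟩, rfl⟩
      exact ⟨⟨B, hB, rfl⟩, Finset.map_subset_map.mpr hT⟩
  constructor
  · intro h
    refine ⟨h.t_le, hcard ▸ h.le_card, h.pos, fun _ _ => Set.subset_univ _, fun B hB => ?_, ?_⟩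
    · rw [← Finset.card_map e]
      exact h.block_card _ ⟨B, hB, rfl⟩
    · intro T _ hT
      rw [← hcount]
      exact h.count _ (by simp) (by rwa [Finset.card_map])
  · intro h
    refine ⟨h.t_le, hcard ▸ h.le_card, h.pos, ?_, ?_, ?_⟩
    · rintro _ ⟨B, _, rfl⟩
      simp
    · rintro _ ⟨B, hB, rfl⟩
      rw [Finset.card_map]
      exact h.block_card _ hB
    · intro T hTV hT
      obtain ⟨T, rfl⟩ : ∃ T' : Finset α, T'.map e = T := by
        obtain ⟨T', -, hT'⟩ := Finset.subset_map_iff (f := e) (t := T.preimage e e.injective.injOn) |>.mp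
          (fun x hx => by
            obtain ⟨a, rfl⟩ := hTV hx
            exact Finset.mem_map_of_mem e (Finset.mem_preimage.mpr hx))
        exact ⟨T', hT'.symm⟩
      rw [hcount]
      exact h.count _ (Set.subset_univ _) (by rwa [Finset.card_map] at hT)

theorem isTDesign_image_map_iff {β : Type*} (e : α ↪ β) {𝓑 : Set (Finset α)} {t : ℕ} :
    IsTDesign (Set.range e) (Finset.map e '' 𝓑) t ↔ IsTDesign Set.univ 𝓑 t :=
  exists₂_congr fun _ _ => isDesign_image_map_iff e

/-- In a `1`-design whose blocks are proper subsets, every point is avoided by some block. -/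
theorem IsTDesign.exists_notMem_of_one [Fintype α] {𝓑 : Set (Finset α)} {k : ℕ}
    (h : IsTDesign Set.univ 𝓑 1) (hk : ∀ B ∈ 𝓑, B.card = k) (hlt : k < Fintype.card α) (a : α) :
    ∃ B ∈ 𝓑, a ∉ B := by
  by_contra! hcon
  obtain ⟨s, l, h⟩ := h
  obtain ⟨B, hB⟩ := h.nonempty
  have hall : {B ∈ 𝓑 | {a} ⊆ B} = 𝓑 := by
    ext B
    simpa using hcon B
  have ha := h.count {a} (Set.subset_univ _) (Finset.card_singleton a)
  -- The index `l` now equals the number of all blocks, so every point lies in every block.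
  rw [hall] at ha
  have huniv : B = Finset.univ := Finset.eq_univ_of_forall fun b => by
    have hb := Set.eq_of_subset_of_ncard_le (fun _ hB => hB.1)
      (ha.trans (h.count {b} (Set.subset_univ _) (Finset.card_singleton b)).symm).le 𝓑.toFinite
    rw [← hb] at hB
    simpa using hB.2
  have := hk B hB
  rw [huniv, Finset.card_univ] at this
  omega

end Designs

/-! ### The elliptic code: dimension, zeros of codewords, dual words. -/

section
variable {F : Type*} [Field F] {W : WeierstrassCurve.Affine F} {n k : ℕ}

theorem eq_zero_of_pointEval_eq_zero (P : Fin n ≃ {Q : W.Point // Q ≠ 0}) (hkn : k < n)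
    {r : W.CoordinateRing} (hr : r ∈ poleSpace W k) (h : ∀ i, pointEval (P i) r = 0) : r = 0 := by
  by_contra h0
  have := card_le_natDegree_norm (Finset.univ.map P.toEmbedding) h0
    fun Q _ => by rw [← P.apply_symm_apply Q]; exact h _
  rw [Finset.card_map, Finset.card_univ, Fintype.card_fin] at this
  have h' : (Algebra.norm F[X] r).natDegree ≤ k := hr
  omega

variable [W.IsElliptic]

theorem finrank_ellipticCode (P : Fin n ≃ {Q : W.Point // Q ≠ 0}) (hk : 1 ≤ k) (hkn : k < n) :
    Module.finrank F (ellipticCode W (fun i => (P i).1) k) = k := by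
  let ev : W.CoordinateRing →ₗ[F] (Fin n → F) := LinearMap.pi fun i => (pointEval (P i)).toLinearMap
  have hC : ellipticCode W (fun i => (P i).1) k = (ev.domRestrict (poleSpace W k)).range := by
    ext c
    rw [mem_ellipticCode, LinearMap.mem_range]
    constructor
    · rintro ⟨r, hr, hc⟩
      exact ⟨⟨r, hr⟩, funext hc⟩
    · rintro ⟨r, hc⟩
      exact ⟨r.1, r.2, congr_fun hc⟩
  rw [hC, LinearMap.finrank_range_of_inj, finrank_poleSpace hk]
  rw [← LinearMap.ker_eq_bot, LinearMap.ker_eq_bot']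
  exact fun r hr => Subtype.ext (eq_zero_of_pointEval_eq_zero P hkn r.2 (congr_fun hr))

theorem ellipticCode_ne_bot (P : Fin n ≃ {Q : W.Point // Q ≠ 0}) (hk : 1 ≤ k) (hkn : k < n) :
    ellipticCode W (fun i => (P i).1) k ≠ ⊥ := by
  intro h
  have := finrank_ellipticCode P hk hkn
  rw [h, finrank_bot] at this
  omega

theorem exists_mem_ellipticCode_of_card_lt (P : Fin n ≃ {Q : W.Point // Q ≠ 0}) (hkn : k < n)
    (S : Finset (Fin n)) (hS : S.card < k) :
    ∃ c ∈ ellipticCode W (fun i => (P i).1) k, c ≠ 0 ∧ ∀ i ∈ S, c i = 0 := by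
  obtain ⟨f, hf, hf0, hfS⟩ := exists_mem_poleSpace_of_card_lt (S.map P.toEmbedding) (k := k)
    (by rwa [Finset.card_map])
  refine ⟨fun i => pointEval (P i) f, (mem_ellipticCode P).mpr ⟨f, hf, fun _ => rfl⟩, fun h => ?_,
    fun i hi => hfS _ (Finset.mem_map_of_mem P.toEmbedding hi)⟩
  exact hf0 (eq_zero_of_pointEval_eq_zero P hkn hf (congr_fun h))

theorem exists_mem_ellipticCode_eval_ne_zero (P : Fin n ≃ {Q : W.Point // Q ≠ 0})
    (S : Finset (Fin n)) (hS : S.card + 2 ≤ k) {i : Fin n} (hi : i ∉ S) :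
    ∃ c ∈ ellipticCode W (fun i => (P i).1) k, (∀ i ∈ S, c i = 0) ∧ c i ≠ 0 := by
  obtain ⟨f, hf, hfS, hfi⟩ := exists_mem_poleSpace_eval_ne_zero (S.map P.toEmbedding) (k := k)
    (by rwa [Finset.card_map]) (Q := P i) (by simpa using hi)
  exact ⟨fun i => pointEval (P i) f, (mem_ellipticCode P).mpr ⟨f, hf, fun _ => rfl⟩,
    fun i hi => hfS _ (Finset.mem_map_of_mem P.toEmbedding hi), hfi⟩

/-- A nonzero dual word of the code `C_L(D, kO)` has weight at least `k`. -/
theorem le_hammingNorm_of_mem_dualCode [DecidableEq F] (P : Fin n ≃ {Q : W.Point // Q ≠ 0})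
    {w : Fin n → F} (hw : w ∈ dualCode (ellipticCode W (fun i => (P i).1) k))
    (h0 : w ≠ 0) : k ≤ hammingNorm w := by
  by_contra! hlt
  obtain ⟨i, hi⟩ := Function.ne_iff.mp h0
  have hiS := mem_wordSupport.mpr hi
  have hcard : ((wordSupport w).erase i).card + 1 = hammingNorm w := by
    rw [Finset.card_erase_add_one hiS, card_wordSupport]
  -- The support of `w` without `i` has at most `k - 2` elements. A codeword vanishing there but not
  -- at `i` pairs with `w` to the single nonzero term `c i * w i`.
  obtain ⟨c, hc, hcS, hci⟩ := exists_mem_ellipticCode_eval_ne_zero (k := k) P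
    ((wordSupport w).erase i) (by omega) (Finset.notMem_erase i _)
  have hsum := hw c hc
  rw [Finset.sum_eq_single i] at hsum
  · exact mul_ne_zero hci hi hsum
  · intro j _ hj
    by_cases hwj : w j = 0
    · rw [hwj, mul_zero]
    · rw [hcS j (Finset.mem_erase.mpr ⟨hj, mem_wordSupport.mpr hwj⟩), zero_mul]
  · simp

variable [DecidableEq F]

theorem card_compl_wordSupport_le (P : Fin n ≃ {Q : W.Point // Q ≠ 0}) {c : Fin n → F}
    (hc : c ∈ ellipticCode W (fun i => (P i).1) k) (h0 : c ≠ 0) : (wordSupport c)ᶜ.card ≤ k := by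
  obtain ⟨r, hr, hrc⟩ := (mem_ellipticCode P).mp hc
  have hr0 : r ≠ 0 := by
    rintro rfl
    exact h0 (funext fun i => by rw [← hrc, map_zero, Pi.zero_apply])
  have := card_le_natDegree_norm ((wordSupport c)ᶜ.map P.toEmbedding) hr0 (by
    simp only [Finset.forall_mem_map, Finset.mem_compl, mem_wordSupport, not_not]
    exact fun i hi => (hrc i).trans hi)
  rw [Finset.card_map] at this
  exact this.trans hr

/-- `k` coordinates are the zeros of a nonzero codeword of `C_L(D, kO)` if and only if the
corresponding points sum to zero. -/
theorem sum_eq_zero_iff_exists_mem_ellipticCode (P : Fin n ≃ {Q : W.Point // Q ≠ 0}) (hkn : k < n)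
    {S : Finset (Fin n)} (hS : S.card = k) : ∑ i ∈ S, (P i).1 = 0 ↔
      ∃ c ∈ ellipticCode W (fun i => (P i).1) k, c ≠ 0 ∧ (wordSupport c)ᶜ = S := by
  have h := sum_eq_zero_iff_exists (S.map P.toEmbedding)
  rw [Finset.sum_map, Finset.card_map, hS] at h
  simp only [Equiv.coe_toEmbedding, Finset.forall_mem_map] at h
  rw [h]
  constructor
  · rintro ⟨r, hr, hr0, hrS⟩
    have hc := (mem_ellipticCode P).mpr ⟨r, hr, fun _ => rfl⟩
    have hc0 : (fun i => pointEval (P i) r) ≠ 0 := fun h0 =>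
      hr0 (eq_zero_of_pointEval_eq_zero P hkn hr (congr_fun h0))
    -- The word vanishes on the `k` indices of `S` and has at most `k` zeros.
    refine ⟨_, hc, hc0, (Finset.eq_of_subset_of_card_le (fun i hi => ?_) ?_).symm⟩
    · simpa [mem_wordSupport] using hrS i hi
    · rw [hS]
      exact card_compl_wordSupport_le P hc hc0
  · rintro ⟨c, hc, hc0, rfl⟩
    obtain ⟨r, hr, hrc⟩ := (mem_ellipticCode P).mp hc
    refine ⟨r, hr, ?_, fun i hi => ?_⟩
    · rintro rfl
      exact hc0 (funext fun i => by rw [← hrc, map_zero, Pi.zero_apply])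
    · rw [hrc]
      simpa [mem_wordSupport] using hi

end

/-- Index sets of size `k` whose points sum to zero. -/
def zeroSumIndexSets {A : Type*} [AddCommGroup A] {n : ℕ} (P : Fin n → A) (k : ℕ) :
    Set (Finset (Fin n)) :=
  {S | S.card = k ∧ ∑ i ∈ S, P i = 0}

theorem image_zeroSumIndexSets {A : Type*} [AddCommGroup A] {n : ℕ}
    (P : Fin n ≃ {Q : A // Q ≠ 0}) (k : ℕ) :
    Finset.map (P.toEmbedding.trans (Function.Embedding.subtype _)) ''
      zeroSumIndexSets (fun i => (P i).1) k = zeroSumSubsets ({0}ᶜ : Set A) k := by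
  ext T
  constructor
  · rintro ⟨S, ⟨hS, hS0⟩, rfl⟩
    refine ⟨?_, by rwa [Finset.card_map], by rw [Finset.sum_map]; exact hS0⟩
    intro a ha
    obtain ⟨i, -, rfl⟩ := Finset.mem_map.mp ha
    exact (P i).2
  · rintro ⟨hT, hTk, hT0⟩
    classical
    obtain ⟨S, rfl⟩ : ∃ S : Finset (Fin n),
        S.map (P.toEmbedding.trans (Function.Embedding.subtype _)) = T := by
      refine ⟨T.preimage _ (P.toEmbedding.trans (Function.Embedding.subtype _)).injective.injOn, ?_⟩
      ext a
      simp only [Finset.mem_map, Finset.mem_preimage]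
      constructor
      · rintro ⟨i, hi, rfl⟩; exact hi
      · intro ha
        exact ⟨P.symm ⟨a, hT ha⟩, by simpa using ha, by simp⟩
    rw [Finset.card_map] at hTk
    rw [Finset.sum_map] at hT0
    exact ⟨S, ⟨hTk, hT0⟩, rfl⟩

/-- Exchanging one index of a zero-sum set for one outside it changes the sum, because `P` is
injective. This excludes the exceptional case in the passage to complementary designs. -/
theorem exists_notMem_zeroSumIndexSets {A : Type*} [AddCommGroup A] {n k : ℕ} {P : Fin n → A}
    (hP : Function.Injective P) (hk : 1 ≤ k) (hkn : k < n) :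
    ∃ S : Finset (Fin n), S.card = k ∧ S ∉ zeroSumIndexSets P k := by
  obtain ⟨S, -, hS⟩ := Finset.exists_subset_card_eq (s := (Finset.univ : Finset (Fin n)))
    (show k ≤ Finset.univ.card by simpa using hkn.le)
  by_cases hS0 : S ∈ zeroSumIndexSets P k
  · obtain ⟨i, hi⟩ := Finset.card_pos.mp (by omega : 0 < S.card)
    obtain ⟨j, hj⟩ : ∃ j, j ∉ S := by
      by_contra! h
      rw [Finset.eq_univ_iff_forall.mpr h, Finset.card_univ, Fintype.card_fin] at hS
      omega
    have hj' : j ∉ S.erase i := fun h => hj (Finset.mem_of_mem_erase h)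
    refine ⟨insert j (S.erase i), ?_, fun h => ?_⟩
    · rw [Finset.card_insert_of_notMem hj', Finset.card_erase_add_one hi, hS]
    · have h1 := h.2
      rw [Finset.sum_insert hj', ← hS0.2, ← Finset.add_sum_erase S P hi, add_left_inj] at h1
      exact hj (hP h1 ▸ hi)
  · exact ⟨S, hS, hS0⟩

/-- When `d = n - k`, the words of minimum weight are the nonzero ones with exactly `k` zeros. -/
theorem minWeightSupports_ellipticCode {F : Type*} [Field F] [DecidableEq F]
    {W : WeierstrassCurve.Affine F} [W.IsElliptic] {n k : ℕ} (P : Fin n ≃ {Q : W.Point // Q ≠ 0})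
    (hkn : k < n) (hd : minDist (ellipticCode W (fun i => (P i).1) k) = n - k) :
    minWeightSupports (ellipticCode W (fun i => (P i).1) k) =
      {B | Bᶜ ∈ zeroSumIndexSets (fun i => (P i).1) k} := by
  ext B
  constructor
  · rintro ⟨c, hc, h0, hcd, rfl⟩
    have hcard : (wordSupport c)ᶜ.card = k := by
      have := card_compl_wordSupport_add c
      omega
    exact ⟨hcard, (sum_eq_zero_iff_exists_mem_ellipticCode P hkn hcard).mpr ⟨c, hc, h0, rfl⟩⟩
  · rintro ⟨hcard, hsum⟩
    obtain ⟨c, hc, h0, hB⟩ := (sum_eq_zero_iff_exists_mem_ellipticCode P hkn hcard).mp hsum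
    rw [compl_inj_iff] at hB
    subst hB
    refine ⟨c, hc, h0, ?_, rfl⟩
    have := card_compl_wordSupport_add c
    omega

/-! ### Minimum distance and the MDS and NMDS properties. -/

section
variable {F : Type*} [Field F] [DecidableEq F] {W : WeierstrassCurve.Affine F} [W.IsElliptic]
  {n k : ℕ} (P : Fin n ≃ {Q : W.Point // Q ≠ 0}) (hk : 1 ≤ k) (hkn : k < n)
include hk hkn

theorem le_minDist_ellipticCode : n ≤ minDist (ellipticCode W (fun i => (P i).1) k) + k := by
  obtain ⟨c, hc, h0, hcd⟩ := exists_hammingNorm_eq_minDist (ellipticCode_ne_bot P hk hkn)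
  have h1 := card_compl_wordSupport_le P hc h0
  have h2 := card_compl_wordSupport_add c
  omega

/-- The Singleton bound: some nonzero codeword vanishes on `k - 1` given coordinates. -/
theorem minDist_ellipticCode_le : minDist (ellipticCode W (fun i => (P i).1) k) + k ≤ n + 1 := by
  obtain ⟨S, -, hS⟩ := Finset.exists_subset_card_eq (s := (Finset.univ : Finset (Fin n)))
    (show k - 1 ≤ Finset.univ.card by rw [Finset.card_univ, Fintype.card_fin]; omega)
  obtain ⟨c, hc, h0, hcS⟩ := exists_mem_ellipticCode_of_card_lt (k := k) P hkn S (by omega)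
  have h1 := minDist_le hc h0
  have h2 := card_compl_wordSupport_add c
  have h3 : S.card ≤ (wordSupport c)ᶜ.card := Finset.card_le_card fun i hi => by
    simpa [mem_wordSupport] using hcS i hi
  omega

theorem minDist_ellipticCode_eq_iff : minDist (ellipticCode W (fun i => (P i).1) k) = n - k ↔
    (zeroSumIndexSets (fun i => (P i).1) k).Nonempty := by
  constructor
  · intro hd
    obtain ⟨c, hc, h0, hcd⟩ := exists_hammingNorm_eq_minDist (ellipticCode_ne_bot P hk hkn)
    have hmem : wordSupport c ∈ minWeightSupports (ellipticCode W (fun i => (P i).1) k) :=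
      ⟨c, hc, h0, hcd, rfl⟩
    rw [minWeightSupports_ellipticCode P hkn hd] at hmem
    exact ⟨_, hmem⟩
  · rintro ⟨S, hS, hsum⟩
    obtain ⟨c, hc, h0, rfl⟩ := (sum_eq_zero_iff_exists_mem_ellipticCode P hkn hS).mp hsum
    have h1 := minDist_le hc h0
    have h2 := card_compl_wordSupport_add c
    have h3 := le_minDist_ellipticCode P hk hkn
    omega

theorem isMDS_ellipticCode_iff : IsMDS (ellipticCode W (fun i => (P i).1) k) ↔
    minDist (ellipticCode W (fun i => (P i).1) k) = n - k + 1 := by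
  rw [IsMDS, finrank_ellipticCode P hk hkn]
  omega

theorem isNMDS_ellipticCode_iff : IsNMDS (ellipticCode W (fun i => (P i).1) k) ↔
    minDist (ellipticCode W (fun i => (P i).1) k) = n - k := by
  have hfin := finrank_ellipticCode P hk hkn
  rw [IsNMDS, IsAMDS, hfin]
  -- One direction uses only that the code itself is almost MDS. For the other, the dual code has
  -- dimension `n - k`, so its minimum distance must be shown to be `k`.
  refine ⟨fun h => by omega, fun hd => ⟨by omega, ?_⟩⟩
  have hdual := finrank_add_finrank_dualCode (ellipticCode W (fun i => (P i).1) k)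
  rw [hfin] at hdual
  obtain ⟨S, hS, hsum⟩ := (minDist_ellipticCode_eq_iff P hk hkn).mp hd
  obtain ⟨c, hc, h0, rfl⟩ := (sum_eq_zero_iff_exists_mem_ellipticCode P hkn hS).mp hsum
  -- The `k` zeros of a minimum-weight codeword carry a nonzero dual word, of weight at most `k`;
  -- the separation property gives the opposite inequality.
  obtain ⟨w, hw, hw0, hwS⟩ := exists_mem_dualCode _ (by rw [hfin, hS]) hc h0
    (fun i hi => by simpa [mem_wordSupport] using hi)
  have h1 : hammingNorm w ≤ k := by
    rw [← card_wordSupport, ← hS]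
    refine Finset.card_le_card fun i hi => ?_
    by_contra hiS
    exact mem_wordSupport.mp hi (hwS i hiS)
  have h2 := minDist_le hw hw0
  obtain ⟨v, hv, hv0, hvd⟩ := exists_hammingNorm_eq_minDist
    (C := dualCode (ellipticCode W (fun i => (P i).1) k)) (fun hb => by
      rw [hb] at hw; exact hw0 ((Submodule.mem_bot F).mp hw))
  have h3 := le_hammingNorm_of_mem_dualCode P hv hv0
  rw [IsAMDS]
  omega

end

end EllipticCode

theorem proposition6p2 {F : Type*} [Field F] [Finite F] [DecidableEq F]
    (E : WeierstrassCurve.Affine F) [E.IsElliptic] (n k : ℕ)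
    (hn : Nat.card E.Point = n + 1)
    (P : Fin n ≃ {Q : E.Point // Q ≠ 0})
    (hk : 1 ≤ k) (hkn : k + 1 ≤ n)
    (C : Submodule F (Fin n → F)) (hC : C = ellipticCode E (fun i => (P i : E.Point)) k) :
    Module.finrank F C = k ∧
    ((IsMDS C ↔ minDist C = n - k + 1) ∧
      (IsMDS C ↔ zeroSumSubsets ({0}ᶜ : Set E.Point) k = ∅) ∧
      (IsNMDS C ↔ minDist C = n - k) ∧
      (IsNMDS C ↔ zeroSumSubsets ({0}ᶜ : Set E.Point) k ≠ ∅)) ∧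
    (IsNMDS C → ∀ t : ℕ,
      (IsTDesign Set.univ (minWeightSupports C) t ↔
        IsTDesign ({0}ᶜ : Set E.Point) (zeroSumSubsets {0}ᶜ k) t)) ∧
    (IsTDesign Set.univ (zeroSumSubsets (Set.univ : Set E.Point) k) 1 → IsNMDS C) := by
  subst hC
  have hmds := isMDS_ellipticCode_iff P hk hkn
  have hnmds := isNMDS_ellipticCode_iff P hk hkn
  have hempty : zeroSumSubsets ({0}ᶜ : Set E.Point) k = ∅ ↔
      ¬ minDist (ellipticCode E (fun i => (P i : E.Point)) k) = n - k := by
    rw [minDist_ellipticCode_eq_iff P hk hkn, ← image_zeroSumIndexSets P, Set.image_eq_empty,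
      Set.not_nonempty_iff_eq_empty]
  have hle := le_minDist_ellipticCode P hk hkn
  have hge := minDist_ellipticCode_le P hk hkn
  refine ⟨finrank_ellipticCode P hk hkn, ⟨hmds, ?_, hnmds, ?_⟩, fun h t => ?_, fun h => ?_⟩
  -- By `hle` and `hge` the distance is `n - k` or `n - k + 1`, so excluding the first value is the
  -- same as having the second.
  · rw [hmds, hempty]; omega
  · rw [hnmds, Ne, hempty, not_not]
  · rw [minWeightSupports_ellipticCode P hkn (hnmds.mp h), isTDesign_compl_iff (fun _ hB => hB.1)
      (exists_notMem_zeroSumIndexSets (P := fun i => (P i : E.Point))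
        (Subtype.val_injective.comp P.injective) hk hkn),
      ← image_zeroSumIndexSets P, ← isTDesign_image_map_iff
        (P.toEmbedding.trans (Function.Embedding.subtype _))]
    have hrange : Set.range (P.toEmbedding.trans (Function.Embedding.subtype _)) =
        ({0}ᶜ : Set E.Point) := by
      ext Q
      constructor
      · rintro ⟨i, rfl⟩; exact (P i).2
      · intro hQ; exact ⟨P.symm ⟨Q, hQ⟩, by simp⟩
    rw [hrange]
  · have : Finite E.Point := Nat.finite_of_card_ne_zero (by omega)
    have := Fintype.ofFinite E.Point
    -- Blocks are proper subsets since `k < n + 1`, so some block avoids the point `O`.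
    obtain ⟨B, hB, h0⟩ := h.exists_notMem_of_one (fun _ hB => hB.2.1)
      (by rw [← Nat.card_eq_fintype_card, hn]; omega) 0
    rw [hnmds, ← not_not (a := minDist _ = _), ← hempty]
    intro he
    have hB' : B ∈ zeroSumSubsets ({0}ᶜ : Set E.Point) k :=
      ⟨fun Q hQ hQ0 => h0 (hQ0 ▸ hQ), hB.2⟩
    rw [he] at hB'
    exact hB'
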